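/- Let $\mathcal X$ be a non-empty compact metric space, let $\mathcal M^+(\mathcal X)$ be the set of finite positive Borel measures on $\mathcal X$ with the weak* topology ($\alpha_n\rightharpoonup\alpha$ iff $\int h\,d\alpha_n\to\int h\,d\alpha$ for all $h\in\mathcal C(\mathcal X)$), and let $C:\mathcal X\times\mathcal X\to\mathbb R$ be continuous, symmetric, with $C(x,x)=0$ and $\gamma$-Lipschitz in each variable. Let $\epsilon>0$, and let $\phi:[0,\infty)\to[0,\infty]$ be an entropy function, i.e. convex and lower semicontinuous with $\phi(1)=0$. Put $\phi'_\infty=\lim_{p\to\infty}\phi(p)/p$, $\phi^*(q)=\sup_{p\ge0}(pq-\phi(p))$ and, with the Lebesgue decomposition $\mu=\frac{d\mu}{d\nu}\nu+\mu^\perp$, $D_\phi(\mu|\nu)=\int\phi\big(\tfrac{d\mu}{d\nu}\big)\,d\nu+\phi'_\infty\,\mu^\perp(\mathcal X)$ (with $\infty\cdot0=0$); $\mathrm{KL}$ is $D_\phi$ for $\phi(p)=p\log p-p+1$. For $\alpha,\beta\in\mathcal M^+(\mathcal X)$ define $$\mathrm{OT}_\epsilon(\alpha,\beta)=\inf_{\pi\in\mathcal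 M^+(\mathcal X^2)}\int C\,d\pi+D_\phi(\pi_1|\alpha)+D_\phi(\pi_2|\beta)+\epsilon\,\mathrm{KL}(\pi|\alpha\otimes\beta)\in(-\infty,+\infty],$$ where $\pi_1,\pi_2$ are the marginals of $\pi$. A pair $(f,g)\in\mathcal C(\mathcal X)^2$ is called a pair of optimal potentials for $(\alpha,\beta)$ if it attains the supremum over $\mathcal C(\mathcal X)^2$ of the dual functional $$-\int\phi^*(-f)\,d\alpha-\int\phi^*(-g)\,d\beta-\epsilon\int\big(e^{(f(x)+g(y)-C(x,y))/\epsilon}-1\big)\,d\alpha(x)\,d\beta(y).$$ 1. For every fixed $\beta$ the functional $\alpha\mapsto\mathrm{OT}_\epsilon(\alpha,\beta)$ is convex on $\mathcal M^+(\mathcal X)$, and for every fixed $\alpha$ the functional $\beta\mapsto\mathrm{OT}_\epsilon(\alpha,\beta)$ is convex on $\mathcal M^+(\mathcal X)$. 2. Unless both $\phi\equiv0$ and $C\equiv0$, the functional $(\alpha,\beta)\mapsto\mathrm{OT}_\epsilon(\alpha,\beta)$ is not jointly convex on $\mathcal M^+(\mathcal X)^2$. 3. Let $\alpha_n\rightharpoonup\alpha$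 and $\beta_n\rightharpoonup\beta$ in $\mathcal M^+(\mathcal X)$, and suppose that for every $n$ there is a pair $(f_n,g_n)$ of optimal potentials for $(\alpha_n,\beta_n)$ such that $\|f_n\|_\infty\le K$ and $\|g_n\|_\infty\le K$ with a constant $K$ independent of $n$. Then $\mathrm{OT}_\epsilon(\alpha_n,\beta_n)\to\mathrm{OT}_\epsilon(\alpha,\beta)$. -/

import Mathlib

open Filter MeasureTheory Topology
open scoped NNReal ENNReal

noncomputable section

/-- Entropy functions `φ : [0, ∞) → [0, ∞]`: convex, lower semicontinuous, with `φ 1 = 0`. -/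
structure IsEntropy (φ : ℝ≥0 → ℝ≥0∞) : Prop where
  convex : ConvexOn ℝ≥0 Set.univ φ
  lsc : LowerSemicontinuous φ
  map_one : φ 1 = 0

/-- The recession constant `lim_{p → ∞} φ p / p`. For a convex `φ` with `φ 1 = 0` the limit exists
in `[0, ∞]`, so that it is the upper limit. -/
def recession (φ : ℝ≥0 → ℝ≥0∞) : ℝ≥0∞ :=
  limsup (fun p : ℝ≥0 => φ p / (p : ℝ≥0∞)) atTop

/-- The `φ`-divergence `D_φ(μ|ν) = ∫ φ(dμ/dν) dν + φ'_∞ μ^⊥(X)`, through the Lebesgue decomposition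
of `μ` with respect to `ν`, with the convention `∞ * 0 = 0`. -/
def csiszarDiv {Ω : Type*} [MeasurableSpace Ω] (φ : ℝ≥0 → ℝ≥0∞) (μ ν : Measure Ω) : ℝ≥0∞ :=
  ∫⁻ x, φ (μ.rnDeriv ν x).toNNReal ∂ν + recession φ * μ.singularPart ν Set.univ

/-- The Legendre conjugate `φ*(q) = sup_{p ≥ 0} (p q - φ p)`, with values in `(-∞, ∞]`. -/
def entropyConj (φ : ℝ≥0 → ℝ≥0∞) (q : ℝ) : EReal :=
  ⨆ p : ℝ≥0, (((p : ℝ) * q : ℝ) : EReal) - (φ p : EReal)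

/-- The integral of an extended-real function as the difference of the integrals of its positive
and negative parts. It is used only for functions whose negative part has a finite integral. -/
def extIntegral {Ω : Type*} [MeasurableSpace Ω] (μ : Measure Ω) (h : Ω → EReal) : EReal :=
  ((∫⁻ x, (h x).toENNReal ∂μ : ℝ≥0∞) : EReal) - ((∫⁻ x, (-h x).toENNReal ∂μ : ℝ≥0∞) : EReal)

/-- Convexity of an extended-real functional on a convex cone such as the positive measures. -/
def IsConvexFunctional {E : Type*} [Add E] [SMul ℝ≥0 E] (F : E → EReal) : Prop :=
  ∀ (x y : E) (s t : ℝ≥0), s + t = 1 →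
    F (s • x + t • y) ≤ ((s : ℝ) : EReal) * F x + ((t : ℝ) : EReal) * F y

section Transport

variable {X : Type*} [MetricSpace X]

/-- Ground costs: continuous, symmetric, zero on the diagonal, and `γ`-Lipschitz in each input. -/
structure IsGroundCost (γ : ℝ≥0) (C : X → X → ℝ) : Prop where
  continuous : Continuous fun z : X × X => C z.1 z.2
  symm : ∀ x y, C x y = C y x
  diag : ∀ x, C x x = 0
  lipschitz : ∀ x, LipschitzWith γ (C x)

variable [MeasurableSpace X] [BorelSpace X]

/-- The primal objective
`∫ C dπ + D_φ(π₁|α) + D_φ(π₂|β) + ε KL(π|α ⊗ β)`. -/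
def transportObjective (φ : ℝ≥0 → ℝ≥0∞) (C : X → X → ℝ) (ε : ℝ) (α β : FiniteMeasure X)
    (π : FiniteMeasure (X × X)) : EReal :=
  ((∫ z, C z.1 z.2 ∂(π : Measure (X × X)) : ℝ) : EReal) +
    ((csiszarDiv φ (π : Measure (X × X)).fst (α : Measure X) +
      csiszarDiv φ (π : Measure (X × X)).snd (β : Measure X) +
      ENNReal.ofReal ε * InformationTheory.klDiv (π : Measure (X × X))
        ((α : Measure X).prod (β : Measure X)) : ℝ≥0∞) : EReal)

/-- The regularized unbalanced optimal transport cost. -/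
def entropicOT (φ : ℝ≥0 → ℝ≥0∞) (C : X → X → ℝ) (ε : ℝ) (α β : FiniteMeasure X) : EReal :=
  ⨅ π : FiniteMeasure (X × X), transportObjective φ C ε α β π

/-- The dual functional
`-⟨α, φ*(-f)⟩ - ⟨β, φ*(-g)⟩ - ε ⟨α ⊗ β, exp((f ⊕ g - C)/ε) - 1⟩`. -/
def dualFunctional (φ : ℝ≥0 → ℝ≥0∞) (C : X → X → ℝ) (ε : ℝ) (α β : FiniteMeasure X)
    (f g : C(X, ℝ)) : EReal :=
  -extIntegral (α : Measure X) (fun x => entropyConj φ (-f x)) -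
    extIntegral (β : Measure X) (fun y => entropyConj φ (-g y)) -
    ((ε * ∫ z, (Real.exp ((f z.1 + g z.2 - C z.1 z.2) / ε) - 1)
      ∂((α : Measure X).prod (β : Measure X)) : ℝ) : EReal)

/-- Optimal potentials: pairs of continuous functions that attain the supremum of the dual
functional over all pairs of continuous functions. -/
def IsOptimalPotentials (φ : ℝ≥0 → ℝ≥0∞) (C : X → X → ℝ) (ε : ℝ) (α β : FiniteMeasure X)
    (f g : C(X, ℝ)) : Prop :=
  ∀ f' g' : C(X, ℝ), dualFunctional φ C ε α β f' g' ≤ dualFunctional φ C ε α β f g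

end Transport

end

/-! Convexity in one marginal: every `φ`-divergence is jointly convex in its two measures
(`IsEntropy.csiszarDiv_combo_le`), and KL is one of them. With `β` fixed, `α ⊗ β` is affine in `α`,
so the primal objective is jointly convex in `(π, α)`, and its infimum over `π` is convex in `α`.
Weak duality at zero potentials excludes the value `-∞`.

Failure of joint convexity: `α ⊗ β` is quadratic in the pair, and multiples of Dirac masses detect
it. Where `φ` penalizes some mass, a segment between two pairs of cost zero passes through `(p δ, p
δ)`, whose cost is positive (`IsEntropy.entropicOT_smul_pointMass_pos`). If `φ` vanishes, the cost
of `(a δ_x, a δ_y)` is `a² k`, with `k ≠ 0` as soon as `C x y ≠ 0`; one segment forces `k ≤ 0` and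
another `k ≥ 0`.

Continuity: for arbitrary continuous `f`, `g`, the cost lies between `dualValue` (weak duality) and
`primalValue`, the objective at the Gibbs plan `exp ((f ⊕ g - c) / ε) α ⊗ β`. In measures and
potentials together, the lower bound is upper semicontinuous and the upper bound lower
semicontinuous. At optimal potentials the two bounds meet: the first-order condition, a continuous
selection and biconjugation give the Fenchel–Young equality almost everywhere between a potential
and the marginal density of the Gibbs plan (`IsEntropy.ae_isConjPair_of_optimal`). Monotonicity of
the subdifferential makes such potentials `γ`-Lipschitz on a set of full measure, so Lipschitz
replacements with the same bound exist and Arzelà–Ascoli applies. Along a convergent subsequence of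
potentials, the reversed semicontinuities squeeze the costs to the cost of the limit. Optimality of
the limit potentials is never needed. -/

noncomputable section

/-! ### Approximation of lower semicontinuous functions -/

/-- Every lower semicontinuous function with values in `[0, ∞]` on a metric space is the limit of an
increasing sequence of bounded continuous functions (Pasch–Hausdorff regularization). -/
theorem LowerSemicontinuous.exists_monotone_continuous {E : Type*} [PseudoMetricSpace E]
    {ψ : E → ℝ≥0∞} (hψ : LowerSemicontinuous ψ) :
    ∃ F : ℕ → E → ℝ≥0∞, (∀ k, Continuous (F k)) ∧ Monotone F ∧ (∀ k x, F k x ≤ k) ∧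
      ∀ x, ⨆ k, F k x = ψ x := by
  refine ⟨fun k x => ⨅ y, min (ψ y) k + k * edist x y, fun k => ?_, fun k l hkl x => ?_,
    fun k x => ?_, fun x => ?_⟩
  · refine continuous_of_le_add_edist k (by simp) fun x y => ?_
    rw [ENNReal.iInf_add]
    refine le_iInf fun z => (iInf_le _ z).trans ?_
    rw [add_assoc, ← mul_add, add_comm (edist y z)]
    gcongr
    exact edist_triangle _ _ _
  · refine iInf_mono fun y => ?_
    have : (k : ℝ≥0∞) ≤ l := by exact_mod_cast hkl
    gcongr
  · refine (iInf_le _ x).trans ?_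
    simp
  · refine le_antisymm (iSup_le fun k => (iInf_le _ x).trans ?_) (le_of_forall_lt fun c hc => ?_)
    · simp
    · obtain ⟨d, hcd, hd⟩ := exists_between hc
      obtain ⟨δ, hδ, hball⟩ := EMetric.mem_nhds_iff.1 (hψ x d hd)
      have hdt : d ≠ ∞ := hd.ne_top
      obtain ⟨δ', hδ', hδδ⟩ : ∃ δ' : ℝ≥0∞, 0 < δ' ∧ δ' ≤ δ ∧ δ' ≠ ∞ :=
        ⟨min δ 1, lt_min hδ one_pos, min_le_left _ _, by simp⟩
      -- Both summands are needed: `k ≥ d` handles the `y` near `x`, where `ψ y > d`, and `k ≥ d /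
      -- δ'` makes the distance penalty alone at least `d` for the other `y`.
      obtain ⟨k, hk⟩ := ENNReal.exists_nat_gt (r := d + d / δ')
        (by simp [hdt, ENNReal.div_eq_top, hδ'.ne'])
      refine hcd.trans_le (le_iSup_of_le k (le_iInf fun y => ?_))
      have h1 : d ≤ k := le_self_add.trans hk.le
      have h2 : d / δ' ≤ k := le_add_self.trans hk.le
      by_cases hy : edist y x < δ'
      · have : d < ψ y := hball (hy.trans_le hδδ.1)
        exact (le_min this.le h1).trans le_self_add
      · rw [not_lt, edist_comm] at hy
        calc d = d / δ' * δ' := (ENNReal.div_mul_cancel hδ'.ne' hδδ.2).symm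
          _ ≤ k * edist x y := by gcongr
          _ ≤ _ := le_add_self

/-! ### The shifted Legendre conjugate -/

/-- The shifted Legendre conjugate `φ*(-t) + t = sup_p ((1 - p) t - φ p)`, which is nonnegative. -/
def conjGap (φ : ℝ≥0 → ℝ≥0∞) (t : ℝ) : ℝ≥0∞ :=
  ⨆ p : ℝ≥0, ENNReal.ofReal ((1 - p) * t) - φ p

theorem conjGap_le_iff {φ : ℝ≥0 → ℝ≥0∞} {t : ℝ} {G : ℝ≥0∞} :
    conjGap φ t ≤ G ↔ ∀ p : ℝ≥0, ENNReal.ofReal ((1 - p) * t) ≤ G + φ p := by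
  simp [conjGap, iSup_le_iff, tsub_le_iff_right]

/-- The Fenchel–Young inequality in shifted form. -/
theorem ofReal_le_add_conjGap (φ : ℝ≥0 → ℝ≥0∞) (p : ℝ≥0) (t : ℝ) :
    ENNReal.ofReal ((1 - p) * t) ≤ φ p + conjGap φ t := by
  rw [add_comm]
  exact conjGap_le_iff.1 le_rfl p

@[simp] theorem conjGap_zero (φ : ℝ≥0 → ℝ≥0∞) : conjGap φ 0 = 0 := by
  simp [conjGap]

theorem lowerSemicontinuous_conjGap (φ : ℝ≥0 → ℝ≥0∞) : LowerSemicontinuous (conjGap φ) := by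
  refine lowerSemicontinuous_iSup fun p => Continuous.lowerSemicontinuous ?_
  by_cases hp : φ p = ∞
  · simpa [hp] using continuous_const
  · exact (ENNReal.continuous_sub_right (φ p)).comp (ENNReal.continuous_ofReal.comp (by fun_prop))

/-- Real-valued bounds of the shifted conjugate are affine constraints. -/
theorem conjGap_le_ofReal_iff {φ : ℝ≥0 → ℝ≥0∞} {t G : ℝ} (hG : 0 ≤ G) :
    conjGap φ t ≤ ENNReal.ofReal G ↔ ∀ p : ℝ≥0, φ p ≠ ∞ → (1 - p) * t ≤ G + (φ p).toReal := by
  rw [conjGap_le_iff]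
  refine forall_congr' fun p => ?_
  by_cases hp : φ p = ∞
  · simp [hp]
  · rw [← ENNReal.ofReal_toReal hp, ← ENNReal.ofReal_add hG ENNReal.toReal_nonneg,
      ENNReal.ofReal_le_ofReal_iff (by positivity)]
    simp

/-- For each `p` the constraint on `(t, G)` is affine, so the admissible pairs form a convex set.
Real bounds `G` keep infinite values out of the continuous selection below. -/
theorem conjGap_combo_le {φ : ℝ≥0 → ℝ≥0∞} {t₁ t₂ G₁ G₂ a b : ℝ} (h₁ : 0 ≤ G₁) (h₂ : 0 ≤ G₂)
    (ha : 0 ≤ a) (hb : 0 ≤ b) (hab : a + b = 1)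
    (ht₁ : conjGap φ t₁ ≤ ENNReal.ofReal G₁) (ht₂ : conjGap φ t₂ ≤ ENNReal.ofReal G₂) :
    conjGap φ (a * t₁ + b * t₂) ≤ ENNReal.ofReal (a * G₁ + b * G₂) := by
  rw [conjGap_le_ofReal_iff h₁] at ht₁
  rw [conjGap_le_ofReal_iff h₂] at ht₂
  rw [conjGap_le_ofReal_iff (by positivity)]
  intro p hp
  have e : (φ p).toReal = a * (φ p).toReal + b * (φ p).toReal := by rw [← add_mul, hab, one_mul]
  rw [e]
  nlinarith [mul_le_mul_of_nonneg_left (ht₁ p hp) ha, mul_le_mul_of_nonneg_left (ht₂ p hp) hb]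

theorem conjGap_convex (φ : ℝ≥0 → ℝ≥0∞) {t₁ t₂ a b : ℝ}
    (ha : 0 ≤ a) (hb : 0 ≤ b) (hab : a + b = 1) :
    conjGap φ (a * t₁ + b * t₂) ≤
      ENNReal.ofReal a * conjGap φ t₁ + ENNReal.ofReal b * conjGap φ t₂ := by
  rcases ha.eq_or_lt with rfl | ha'
  · simp_all
  rcases hb.eq_or_lt with rfl | hb'
  · simp_all
  by_cases h₁ : conjGap φ t₁ = ∞
  · simp [h₁, ENNReal.mul_top, ha']
  by_cases h₂ : conjGap φ t₂ = ∞
  · simp [h₂, ENNReal.mul_top, hb']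
  have := conjGap_combo_le (φ := φ) ENNReal.toReal_nonneg ENNReal.toReal_nonneg ha hb hab
    (ENNReal.ofReal_toReal h₁).ge (ENNReal.ofReal_toReal h₂).ge
  rwa [ENNReal.ofReal_add (by positivity) (by positivity), ENNReal.ofReal_mul ha,
    ENNReal.ofReal_mul hb, ENNReal.ofReal_toReal h₁, ENNReal.ofReal_toReal h₂] at this

/-- The conjugate in terms of the shifted conjugate. -/
theorem entropyConj_neg {φ : ℝ≥0 → ℝ≥0∞} (h1 : φ 1 = 0) (t : ℝ) :
    entropyConj φ (-t) = (conjGap φ t : EReal) - (t : EReal) := by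
  have key : ∀ a : EReal, entropyConj φ (-t) ≤ a ↔ (conjGap φ t : EReal) - (t : EReal) ≤ a := by
    intro a
    rw [EReal.sub_le_iff_le_add (by simp) (by simp), entropyConj, iSup_le_iff]
    have h0 : (0 : EReal) = ((0 : ℝ≥0∞) : EReal) := rfl
    constructor
    · intro h
      -- The term `p = 1` makes `a + t` nonnegative, so the comparison can be moved to `ℝ≥0∞`.
      have hnn : 0 ≤ a + (t : EReal) := by
        have := h 1
        rw [h1, ← h0, sub_zero] at this
        have h2 := add_le_add_left this (t : EReal)
        rw [← EReal.coe_add] at h2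
        simpa using h2
      rw [← EReal.coe_toENNReal hnn, EReal.coe_ennreal_le_coe_ennreal_iff, conjGap_le_iff]
      intro p
      rw [← EReal.coe_ennreal_le_coe_ennreal_iff, EReal.coe_ennreal_add, EReal.coe_toENNReal hnn,
        EReal.coe_ennreal_ofReal, EReal.coe_strictMono.monotone.map_max]
      refine max_le ?_ (add_nonneg hnn (EReal.coe_ennreal_nonneg _))
      have := h p
      rw [EReal.sub_le_iff_le_add (by simp) (.inr (by rintro rfl; simp at hnn))] at this
      have h2 := add_le_add_left this (t : EReal)
      rw [← EReal.coe_add] at h2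
      convert h2 using 1
      · congr 1; ring
      · ac_rfl
    · intro h p
      have hnn : 0 ≤ a + (t : EReal) := (EReal.coe_ennreal_nonneg _).trans h
      rw [← EReal.coe_toENNReal hnn, EReal.coe_ennreal_le_coe_ennreal_iff, conjGap_le_iff] at h
      have := h p
      rw [← EReal.coe_ennreal_le_coe_ennreal_iff, EReal.coe_ennreal_add, EReal.coe_toENNReal hnn,
        EReal.coe_ennreal_ofReal, EReal.coe_strictMono.monotone.map_max] at this
      have h2 := add_le_add_left ((le_max_left _ _).trans this) ((-t : ℝ) : EReal)
      rw [← EReal.coe_add] at h2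
      rw [EReal.sub_le_iff_le_add (by simp) (.inr (by rintro rfl; simp at hnn))]
      convert h2 using 1
      · congr 1; ring
      · rw [add_right_comm, add_assoc a, ← EReal.coe_add]; simp
  exact le_antisymm ((key _).2 le_rfl) ((key _).1 le_rfl)

/-- A finite value at `t` gives the affine minorant `(1 - p) t - conjGap φ t` of `φ`, of slope `-t`;
dividing by `p` and letting `p → ∞` compares the slope with the recession constant. -/
theorem neg_le_recession {φ : ℝ≥0 → ℝ≥0∞} {t : ℝ} (ht : conjGap φ t ≠ ∞) :
    ENNReal.ofReal (-t) ≤ recession φ := by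
  refine le_of_forall_lt fun c hc => ?_
  have hct : c ≠ ∞ := hc.ne_top
  lift c to ℝ≥0 using hct
  have hct' : (c : ℝ) < -t := by
    have := ENNReal.lt_ofReal_iff_toReal_lt (by simp : (c : ℝ≥0∞) ≠ ∞) |>.1 hc
    simpa using this
  obtain ⟨c', hcc', hc't⟩ := exists_between hct'
  lift c' to ℝ≥0 using (c.2.trans hcc'.le)
  refine lt_of_lt_of_le (b := (c' : ℝ≥0∞)) (by exact_mod_cast hcc') ?_
  refine le_limsup_of_frequently_le (Eventually.frequently ?_)
  set G := (conjGap φ t).toReal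
  -- Beyond this threshold the affine minorant is at least `c' p`.
  have hev : ∀ᶠ p : ℝ≥0 in atTop, (1 : ℝ≥0) ≤ p ∧ (((G + |t|) / (-t - c')).toNNReal) ≤ p :=
    (eventually_ge_atTop _).and (eventually_ge_atTop _)
  filter_upwards [hev] with p ⟨hp1, hp⟩
  have hp0 : (0 : ℝ) < p := by exact_mod_cast zero_lt_one.trans_le hp1
  rw [ENNReal.le_div_iff_mul_le (by left; exact_mod_cast hp0.ne') (by simp)]
  by_cases hpt : φ p = ∞
  · simp [hpt]
  rw [← ENNReal.coe_mul, ← ENNReal.ofReal_coe_nnreal]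
  refine ENNReal.ofReal_le_of_le_toReal ?_
  have h1 := (conjGap_le_ofReal_iff ENNReal.toReal_nonneg).1 (ENNReal.ofReal_toReal ht).ge p hpt
  have h2 : (G + |t|) / (-t - c') ≤ p := Real.toNNReal_le_iff_le_coe.1 hp
  rw [div_le_iff₀ (by linarith)] at h2
  have h3 := neg_abs_le t
  push_cast
  simp only [G] at h2
  nlinarith

/-! ### Biconjugation and growth of entropy functions -/

namespace IsEntropy

variable {φ : ℝ≥0 → ℝ≥0∞}

/-- Hahn–Banach separation of the point `(p, c)` from the closed convex epigraph. The truncation by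
`ENNReal.ofReal` is harmless because `φ ≥ 0`, and it is what allows vertical separating lines. -/
theorem exists_affine_minorant (hφ : IsEntropy φ) {p : ℝ≥0} {c : ℝ} (hc : 0 ≤ c)
    (h : ENNReal.ofReal c < φ p) :
    ∃ q d : ℝ, (∀ r : ℝ≥0, ENNReal.ofReal (q * r + d) ≤ φ r) ∧ c < q * p + d := by
  set S : Set (ℝ × ℝ) := {z | 0 ≤ z.1 ∧ 0 ≤ z.2 ∧ φ z.1.toNNReal ≤ ENNReal.ofReal z.2} with hS
  have hclosed : IsClosed S := by
    refine (isClosed_le continuous_const continuous_fst).inter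
      ((isClosed_le continuous_const continuous_snd).inter ?_)
    exact hφ.lsc.isClosed_epigraph.preimage
      (f := fun z : ℝ × ℝ => (z.1.toNNReal, ENNReal.ofReal z.2))
      (by have := ENNReal.continuous_ofReal; fun_prop)
  have hconv : Convex ℝ S := by
    rintro ⟨x, s⟩ ⟨hx, hs, hxs⟩ ⟨y, t⟩ ⟨hy, ht, hyt⟩ a b ha hb hab
    simp only at hx hs hxs hy ht hyt
    refine ⟨by simp; positivity, by simp; positivity, ?_⟩
    have := hφ.convex.2 (Set.mem_univ x.toNNReal) (Set.mem_univ y.toNNReal)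
      (zero_le (a := a.toNNReal)) (zero_le (a := b.toNNReal))
      (by rw [← Real.toNNReal_add ha hb, hab, Real.toNNReal_one])
    simp only [smul_eq_mul, ← Real.toNNReal_mul ha, ← Real.toNNReal_mul hb, Prod.smul_mk,
      Prod.mk_add_mk] at this ⊢
    rw [Real.toNNReal_add (by positivity) (by positivity)]
    refine this.trans ?_
    rw [ENNReal.ofReal_add (by positivity) (by positivity), ENNReal.ofReal_mul ha,
      ENNReal.ofReal_mul hb]
    simp only [ENNReal.smul_def, smul_eq_mul]
    exact add_le_add (mul_le_mul_right hxs _) (mul_le_mul_right hyt _)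
  have hnot : ((p : ℝ), c) ∉ S := by
    rintro ⟨-, -, h3⟩
    simp only [Real.toNNReal_coe] at h3
    exact absurd h h3.not_gt
  obtain ⟨ℓ, u, hℓ1, hℓ2⟩ := geometric_hahn_banach_point_closed hconv hclosed hnot
  set a := ℓ (1, 0)
  set b := ℓ (0, 1)
  have hℓ : ∀ x t : ℝ, ℓ (x, t) = a * x + b * t := by
    intro x t
    have : ((x, t) : ℝ × ℝ) = x • (1, 0) + t • (0, 1) := by simp
    rw [this, map_add, map_smul, map_smul, smul_eq_mul, smul_eq_mul, mul_comm x, mul_comm t]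
  have hepi : ∀ r : ℝ≥0, φ r ≠ ∞ → ∀ t : ℝ, (φ r).toReal ≤ t → u < a * r + b * t := by
    intro r hr t ht
    rw [← hℓ]
    refine hℓ2 _ ⟨r.2, ENNReal.toReal_nonneg.trans ht, ?_⟩
    simpa using (ENNReal.le_ofReal_iff_toReal_le hr (ENNReal.toReal_nonneg.trans ht)).2 ht
  rw [hℓ] at hℓ1
  -- The epigraph contains the half-line above `(1, 0)`, on which a negative `b` would violate the
  -- separation.
  have hb : 0 ≤ b := by
    by_contra! hb
    have h1 := hepi 1 (by simp [hφ.map_one]) (max 0 ((u - a) / b)) (by simp [hφ.map_one])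
    have h2 : b * max 0 ((u - a) / b) ≤ b * ((u - a) / b) :=
      mul_le_mul_of_nonpos_left (le_max_right _ _) hb.le
    rw [mul_div_cancel₀ _ hb.ne] at h2
    simp only [NNReal.coe_one] at h1
    linarith
  rcases hb.eq_or_lt with hb0 | hb0
  · rw [← hb0] at hℓ1 hepi
    have hup : 0 < u - a * p := by linarith
    -- Vertical line: `u - a r` is negative on the domain of `φ` and positive at `p`. The multiple
    -- is chosen so that its value at `p` is `c + (u - a p)`.
    refine ⟨-((c / (u - a * p) + 1) * a), (c / (u - a * p) + 1) * u, fun r => ?_, ?_⟩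
    · by_cases hr : φ r = ∞
      · simp [hr]
      · have := hepi r hr _ le_rfl
        rw [ENNReal.ofReal_of_nonpos]
        · exact zero_le
        · have h0 : 0 ≤ c / (u - a * p) + 1 := by positivity
          nlinarith
    · have : (c / (u - a * p) + 1) * (u - a * p) = c + (u - a * p) := by
        field_simp
      nlinarith
  · refine ⟨-a / b, u / b, fun r => ?_, ?_⟩
    · by_cases hr : φ r = ∞
      · simp [hr]
      · have := hepi r hr _ le_rfl
        refine ENNReal.ofReal_le_of_le_toReal ?_
        have e : -a / b * r + u / b = (u - a * r) / b := by ring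
        rw [e, div_le_iff₀ hb0]
        linarith
    · have e : -a / b * p + u / b = (u - a * p) / b := by ring
      rw [e, lt_div_iff₀ hb0]
      linarith

/-- Biconjugation, in terms of the shifted conjugate. -/
theorem exists_conjGap_lt (hφ : IsEntropy φ) {p : ℝ≥0} {c : ℝ}
    (h : c < 0 ∨ ENNReal.ofReal c < φ p) :
    ∃ t G : ℝ, 0 ≤ G ∧ conjGap φ t ≤ ENNReal.ofReal G ∧ c + G < (1 - p) * t := by
  by_cases hc : c < 0
  · exact ⟨0, 0, le_rfl, by simp, by simpa using hc⟩
  obtain ⟨q, d, hqd, hlt⟩ := hφ.exists_affine_minorant (not_lt.1 hc) (h.resolve_left hc)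
  -- The minorant cannot be positive at `1`, where `φ` vanishes. With `t = -q` and `G = -d - q`, the
  -- quantity `(1 - p) t - G` is `q p + d`.
  have hG : 0 ≤ -d - q := by
    have := hqd 1
    rw [hφ.map_one, nonpos_iff_eq_zero, ENNReal.ofReal_eq_zero] at this
    simp only [NNReal.coe_one] at this
    linarith
  refine ⟨-q, -d - q, hG, (conjGap_le_ofReal_iff hG).2 fun r hr => ?_, by linarith⟩
  have := (ENNReal.ofReal_le_iff_le_toReal hr).1 (hqd r)
  linarith

theorem measurable (hφ : IsEntropy φ) : Measurable φ := hφ.lsc.measurable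

/-- The growth of an entropy function is controlled by its recession constant. -/
theorem map_add_le (hφ : IsEntropy φ) (x u : ℝ≥0) : φ (x + u) ≤ φ x + recession φ * u := by
  refine le_of_forall_lt fun c hc => ?_
  have hct : c ≠ ∞ := hc.ne_top
  lift c to ℝ≥0 using hct
  by_cases hx : φ x = ∞
  · simp [hx]
  -- A dual slope `t` that almost attains `φ (x + u)`. Split `(1 - x - u) t`: the Fenchel–Young
  -- inequality at `x` bounds `(1 - x) t - G`, and `-t` is at most the recession constant.
  obtain ⟨t, G, hG, htG, hlt⟩ := hφ.exists_conjGap_lt (p := x + u) (c := c) (Or.inr (by simpa))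
  have h1 := (conjGap_le_ofReal_iff hG).1 htG x hx
  have h2 := neg_le_recession (t := t) (htG.trans_lt ENNReal.ofReal_lt_top).ne
  have h3 : (c : ℝ) < (φ x).toReal + max (-t) 0 * u := by
    rw [NNReal.coe_add] at hlt
    nlinarith [mul_le_mul_of_nonneg_right (le_max_left (-t) 0) u.coe_nonneg]
  calc (c : ℝ≥0∞) = ENNReal.ofReal c := by simp
    _ < ENNReal.ofReal ((φ x).toReal + max (-t) 0 * u) :=
      (ENNReal.ofReal_lt_ofReal_iff (c.2.trans_lt h3)).2 h3
    _ = φ x + ENNReal.ofReal (-t) * u := by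
      rw [ENNReal.ofReal_add (by simp) (by positivity), ENNReal.ofReal_toReal hx,
        ENNReal.ofReal_mul (by simp), ENNReal.ofReal_coe_nnreal, ENNReal.ofReal_max]
      simp
    _ ≤ φ x + recession φ * u := by gcongr

end IsEntropy

/-! ### Kullback–Leibler as a `φ`-divergence -/

open InformationTheory in
/-- The entropy function of the Kullback–Leibler divergence. -/
def klEntropy (p : ℝ≥0) : ℝ≥0∞ := ENNReal.ofReal (klFun p)

open InformationTheory in
theorem isEntropy_klEntropy : IsEntropy klEntropy where
  convex := by
    refine ⟨convex_univ, fun x _ y _ a b _ _ hab => ?_⟩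
    have hab' : (a : ℝ) + b = 1 := by exact_mod_cast hab
    have := convexOn_klFun.2 (Set.mem_Ici.2 x.coe_nonneg) (Set.mem_Ici.2 y.coe_nonneg)
      a.coe_nonneg b.coe_nonneg hab'
    simp only [klEntropy, smul_eq_mul, ENNReal.smul_def, NNReal.coe_add, NNReal.coe_mul] at this ⊢
    refine (ENNReal.ofReal_le_ofReal this).trans ?_
    rw [ENNReal.ofReal_add (mul_nonneg a.coe_nonneg (klFun_nonneg x.coe_nonneg))
      (mul_nonneg b.coe_nonneg (klFun_nonneg y.coe_nonneg)),
      ENNReal.ofReal_mul a.coe_nonneg, ENNReal.ofReal_mul b.coe_nonneg, ENNReal.ofReal_coe_nnreal,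
      ENNReal.ofReal_coe_nnreal]
  lsc := (ENNReal.continuous_ofReal.comp
    (continuous_klFun.comp NNReal.continuous_coe)).lowerSemicontinuous
  map_one := by simp [klEntropy, klFun_one]

open InformationTheory in
theorem recession_klEntropy : recession klEntropy = ∞ := by
  rw [recession]
  have h : Tendsto (fun p : ℝ≥0 => klEntropy p / (p : ℝ≥0∞)) atTop (𝓝 ∞) := by
    have h1 : Tendsto (fun p : ℝ≥0 => ENNReal.ofReal (Real.log p - 1)) atTop (𝓝 ∞) :=
      ENNReal.tendsto_ofReal_nhds_top.2 (tendsto_atTop_add_const_right _ _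
        (Real.tendsto_log_atTop.comp (NNReal.tendsto_coe_atTop.2 tendsto_id)))
    refine tendsto_nhds_top_mono h1 ?_
    filter_upwards [eventually_gt_atTop 0] with p hp
    rw [ENNReal.le_div_iff_mul_le (by left; exact_mod_cast hp.ne') (by simp), klEntropy,
      ← ENNReal.ofReal_coe_nnreal, ← ENNReal.ofReal_mul' p.coe_nonneg]
    refine ENNReal.ofReal_le_ofReal ?_
    rw [klFun_apply]
    nlinarith
  exact h.limsup_eq

-- The infinite recession constant charges `∞` for any singular part, which is the convention of
-- `klDiv`. General facts on divergences thus cover the entropic term.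
open InformationTheory in
theorem klDiv_eq_csiszarDiv {Ω : Type*} [MeasurableSpace Ω] (μ ν : Measure Ω)
    [IsFiniteMeasure μ] [IsFiniteMeasure ν] : klDiv μ ν = csiszarDiv klEntropy μ ν := by
  classical
  rw [klDiv_eq_lintegral_klFun, csiszarDiv, recession_klEntropy]
  split_ifs with h
  · simp [Measure.singularPart_eq_zero_of_ac h, klEntropy, ENNReal.coe_toNNReal_eq_toReal]
  · have : μ.singularPart ν Set.univ ≠ 0 := by
      rwa [Ne, Measure.measure_univ_eq_zero, Measure.singularPart_eq_zero]
    simp [ENNReal.top_mul this]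

/-! ### Joint convexity of the divergences -/

section Divergence

variable {Ω : Type*} [MeasurableSpace Ω] {φ : ℝ≥0 → ℝ≥0∞}

theorem csiszarDiv_withDensity (φ : ℝ≥0 → ℝ≥0∞) (ν : Measure Ω)
    [SigmaFinite ν] {r : Ω → ℝ≥0} (hr : Measurable r) :
    csiszarDiv φ (ν.withDensity fun x => r x) ν = ∫⁻ x, φ (r x) ∂ν := by
  have h0 : (ν.withDensity fun x => (r x : ℝ≥0∞)).singularPart ν = 0 :=
    Measure.singularPart_withDensity _ _
  rw [csiszarDiv, h0]
  simp only [Measure.coe_zero, Pi.zero_apply, mul_zero, add_zero]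
  refine lintegral_congr_ae ?_
  filter_upwards [Measure.rnDeriv_withDensity ν hr.coe_nnreal_ennreal] with x hx
  rw [hx, ENNReal.toNNReal_coe]

theorem eq_withDensity_toNNReal_rnDeriv_add (μ ν : Measure Ω) [IsFiniteMeasure μ]
    [IsFiniteMeasure ν] :
    μ = (ν.withDensity fun x => ((μ.rnDeriv ν x).toNNReal : ℝ≥0∞)) + μ.singularPart ν := by
  conv_lhs => rw [μ.haveLebesgueDecomposition_add ν, add_comm]
  congr 1
  refine withDensity_congr_ae ?_
  filter_upwards [μ.rnDeriv_ne_top ν] with x hx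
  rw [ENNReal.coe_toNNReal hx]

/-- A decomposition of `μ` into a part with a density and any remainder bounds the divergence. -/
theorem IsEntropy.csiszarDiv_withDensity_add_le (hφ : IsEntropy φ) (ν σ : Measure Ω)
    [IsFiniteMeasure ν] [IsFiniteMeasure σ] {r : Ω → ℝ≥0} (hr : Measurable r) :
    csiszarDiv φ ((ν.withDensity fun x => r x) + σ) ν ≤
      ∫⁻ x, φ (r x) ∂ν + recession φ * σ Set.univ := by
  set u : Ω → ℝ≥0 := fun x => (σ.rnDeriv ν x).toNNReal
  have hu : Measurable u := (Measure.measurable_rnDeriv σ ν).ennreal_toNNReal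
  have hσ := eq_withDensity_toNNReal_rnDeriv_add σ ν
  -- The remainder `σ` need not be singular to `ν`: its density `u` joins `r`, and the growth bound
  -- pays for `u` at the same rate as for singular mass.
  have hdec : (ν.withDensity fun x => (r x : ℝ≥0∞)) + σ =
      σ.singularPart ν + ν.withDensity fun x => ((r x + u x : ℝ≥0) : ℝ≥0∞) := by
    simp only [ENNReal.coe_add]
    rw [← Pi.add_def, withDensity_add_left hr.coe_nnreal_ennreal]
    conv_lhs => rw [hσ]
    rw [← add_assoc, add_comm]
  have hmeas : Measurable fun x => ((r x + u x : ℝ≥0) : ℝ≥0∞) := (hr.add hu).coe_nnreal_ennreal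
  have hrn := Measure.eq_rnDeriv hmeas (Measure.mutuallySingular_singularPart σ ν) hdec
  have hsing := Measure.eq_singularPart hmeas (Measure.mutuallySingular_singularPart σ ν) hdec
  have hmass : ∫⁻ x, u x ∂ν + σ.singularPart ν Set.univ = σ Set.univ := by
    conv_rhs => rw [hσ]
    simp [u]
  calc csiszarDiv φ ((ν.withDensity fun x => r x) + σ) ν
      = ∫⁻ x, φ (r x + u x) ∂ν + recession φ * σ.singularPart ν Set.univ := by
        rw [csiszarDiv, ← hsing]
        congr 1
        refine lintegral_congr_ae ?_
        filter_upwards [hrn] with x hx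
        rw [← hx, ENNReal.toNNReal_coe]
    _ ≤ ∫⁻ x, φ (r x) + recession φ * u x ∂ν + recession φ * σ.singularPart ν Set.univ := by
        gcongr with x
        exact hφ.map_add_le _ _
    _ = ∫⁻ x, φ (r x) ∂ν + recession φ * σ Set.univ := by
        have hm : Measurable fun x => φ (r x) := hφ.measurable.comp hr
        rw [lintegral_add_left hm,
          lintegral_const_mul _ hu.coe_nnreal_ennreal, add_assoc, ← mul_add, hmass]

/-- Joint convexity of the divergences. -/
theorem IsEntropy.csiszarDiv_combo_le (hφ : IsEntropy φ) (μ₁ μ₂ ν₁ ν₂ : Measure Ω)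
    [IsFiniteMeasure μ₁] [IsFiniteMeasure μ₂] [IsFiniteMeasure ν₁] [IsFiniteMeasure ν₂]
    (s t : ℝ≥0) :
    csiszarDiv φ (s • μ₁ + t • μ₂) (s • ν₁ + t • ν₂) ≤
      s * csiszarDiv φ μ₁ ν₁ + t * csiszarDiv φ μ₂ ν₂ := by
  set ν := s • ν₁ + t • ν₂ with hν
  set r₁ : Ω → ℝ≥0 := fun x => (μ₁.rnDeriv ν₁ x).toNNReal
  set r₂ : Ω → ℝ≥0 := fun x => (μ₂.rnDeriv ν₂ x).toNNReal
  -- The densities of `s • ν₁` and `t • ν₂` with respect to their sum add up to `1` almost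
  -- everywhere; they are the pointwise weights in the convexity inequality for `φ`.
  set b₁ : Ω → ℝ≥0 := fun x => ((s • ν₁).rnDeriv ν x).toNNReal
  set b₂ : Ω → ℝ≥0 := fun x => ((t • ν₂).rnDeriv ν x).toNNReal
  have mr₁ : Measurable r₁ := (Measure.measurable_rnDeriv _ _).ennreal_toNNReal
  have mr₂ : Measurable r₂ := (Measure.measurable_rnDeriv _ _).ennreal_toNNReal
  have mb₁ : Measurable b₁ := (Measure.measurable_rnDeriv _ _).ennreal_toNNReal
  have mb₂ : Measurable b₂ := (Measure.measurable_rnDeriv _ _).ennreal_toNNReal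
  have ac₁ : s • ν₁ ≪ ν := Measure.le_add_right le_rfl |>.absolutelyContinuous
  have ac₂ : t • ν₂ ≪ ν := Measure.le_add_left le_rfl |>.absolutelyContinuous
  have d₁ : (ν.withDensity fun x => (b₁ x : ℝ≥0∞)) = s • ν₁ := by
    conv_rhs => rw [eq_withDensity_toNNReal_rnDeriv_add (s • ν₁) ν,
      Measure.singularPart_eq_zero_of_ac ac₁, add_zero]
  have d₂ : (ν.withDensity fun x => (b₂ x : ℝ≥0∞)) = t • ν₂ := by
    conv_rhs => rw [eq_withDensity_toNNReal_rnDeriv_add (t • ν₂) ν,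
      Measure.singularPart_eq_zero_of_ac ac₂, add_zero]
  have hb : ∀ᵐ x ∂ν, b₁ x + b₂ x = 1 := by
    have h1 : (ν.withDensity fun x => ((b₁ x + b₂ x : ℝ≥0) : ℝ≥0∞)) =
        ν.withDensity fun _ => ((1 : ℝ≥0) : ℝ≥0∞) := by
      simp only [ENNReal.coe_add]
      rw [← Pi.add_def, withDensity_add_left mb₁.coe_nnreal_ennreal, d₁, d₂]
      simp only [ENNReal.coe_one]
      rw [← Pi.one_def, withDensity_one]
    have h2 := (withDensity_eq_iff (f := fun x => ((b₁ x + b₂ x : ℝ≥0) : ℝ≥0∞))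
      (mb₁.add mb₂).coe_nnreal_ennreal.aemeasurable
      measurable_const.aemeasurable (by
        rw [← setLIntegral_univ, ← withDensity_apply _ MeasurableSet.univ, h1]
        rw [withDensity_apply _ MeasurableSet.univ]
        simp)).1 h1
    filter_upwards [h2] with x hx
    exact_mod_cast hx
  have hφb : ∀ᵐ x ∂ν, φ (b₁ x * r₁ x + b₂ x * r₂ x) ≤ b₁ x * φ (r₁ x) + b₂ x * φ (r₂ x) := by
    filter_upwards [hb] with x hx
    have := hφ.convex.2 (Set.mem_univ (r₁ x)) (Set.mem_univ (r₂ x)) zero_le zero_le hx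
    simpa [ENNReal.smul_def] using this
  -- The singular parts are relative to `ν₁` and `ν₂` separately, and may charge what `ν` charges;
  -- hence the bound for arbitrary remainders.
  have hdec : s • μ₁ + t • μ₂ =
      (ν.withDensity fun x => ((b₁ x * r₁ x + b₂ x * r₂ x : ℝ≥0) : ℝ≥0∞)) +
        (s • μ₁.singularPart ν₁ + t • μ₂.singularPart ν₂) := by
    simp only [ENNReal.coe_add, ENNReal.coe_mul]
    have e : (fun x => (b₁ x * r₁ x + b₂ x * r₂ x : ℝ≥0∞)) =
        ((fun x => (b₁ x : ℝ≥0∞)) * fun x => (r₁ x : ℝ≥0∞)) +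
        ((fun x => (b₂ x : ℝ≥0∞)) * fun x => (r₂ x : ℝ≥0∞)) := rfl
    rw [e, withDensity_add_left (mb₁.coe_nnreal_ennreal.mul mr₁.coe_nnreal_ennreal),
      withDensity_mul _ mb₁.coe_nnreal_ennreal mr₁.coe_nnreal_ennreal,
      withDensity_mul _ mb₂.coe_nnreal_ennreal mr₂.coe_nnreal_ennreal, d₁, d₂]
    conv_lhs => rw [eq_withDensity_toNNReal_rnDeriv_add μ₁ ν₁,
      eq_withDensity_toNNReal_rnDeriv_add μ₂ ν₂]
    have w₁ : (s • ν₁).withDensity (fun x => (r₁ x : ℝ≥0∞)) =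
        s • ν₁.withDensity fun x => (r₁ x : ℝ≥0∞) := withDensity_smul_measure _ _
    have w₂ : (t • ν₂).withDensity (fun x => (r₂ x : ℝ≥0∞)) =
        t • ν₂.withDensity fun x => (r₂ x : ℝ≥0∞) := withDensity_smul_measure _ _
    rw [w₁, w₂, smul_add, smul_add]
    abel
  have i₁ : ∫⁻ x, b₁ x * φ (r₁ x) ∂ν = s * ∫⁻ x, φ (r₁ x) ∂ν₁ := by
    have := lintegral_withDensity_eq_lintegral_mul ν mb₁.coe_nnreal_ennreal
      (hφ.measurable.comp mr₁)
    rw [d₁] at this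
    exact this.symm.trans (lintegral_smul_measure _ _)
  have i₂ : ∫⁻ x, b₂ x * φ (r₂ x) ∂ν = t * ∫⁻ x, φ (r₂ x) ∂ν₂ := by
    have := lintegral_withDensity_eq_lintegral_mul ν mb₂.coe_nnreal_ennreal
      (hφ.measurable.comp mr₂)
    rw [d₂] at this
    exact this.symm.trans (lintegral_smul_measure _ _)
  calc csiszarDiv φ (s • μ₁ + t • μ₂) ν
      ≤ ∫⁻ x, φ (b₁ x * r₁ x + b₂ x * r₂ x) ∂ν +
          recession φ * (s • μ₁.singularPart ν₁ + t • μ₂.singularPart ν₂) Set.univ := by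
        rw [hdec]
        exact hφ.csiszarDiv_withDensity_add_le _ _ ((mb₁.mul mr₁).add (mb₂.mul mr₂))
    _ ≤ ∫⁻ x, b₁ x * φ (r₁ x) + b₂ x * φ (r₂ x) ∂ν +
          recession φ * (s • μ₁.singularPart ν₁ + t • μ₂.singularPart ν₂) Set.univ :=
        add_le_add_left (lintegral_mono_ae hφb) _
    _ = s * csiszarDiv φ μ₁ ν₁ + t * csiszarDiv φ μ₂ ν₂ := by
        have hm : Measurable fun x => (b₁ x : ℝ≥0∞) * φ (r₁ x) :=
          mb₁.coe_nnreal_ennreal.mul (hφ.measurable.comp mr₁)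
        rw [lintegral_add_left hm, i₁, i₂,
          csiszarDiv, csiszarDiv]
        simp only [Measure.coe_add, Pi.add_apply, Measure.smul_apply, ENNReal.smul_def, smul_eq_mul]
        ring

end Divergence

/-! ### Convexity of the primal objective -/

section ConvexObjective

variable {X : Type*} [MetricSpace X] [CompactSpace X] [MeasurableSpace X] [BorelSpace X]

theorem measure_fst_combo {Ω Ω' : Type*} [MeasurableSpace Ω] [MeasurableSpace Ω']
    (μ ν : Measure (Ω × Ω')) (s t : ℝ≥0) :
    (s • μ + t • ν).fst = s • μ.fst + t • ν.fst := by
  rw [Measure.fst, Measure.map_add _ _ measurable_fst, Measure.map_smul, Measure.map_smul]; rfl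

theorem measure_snd_combo {Ω Ω' : Type*} [MeasurableSpace Ω] [MeasurableSpace Ω']
    (μ ν : Measure (Ω × Ω')) (s t : ℝ≥0) :
    (s • μ + t • ν).snd = s • μ.snd + t • ν.snd := by
  rw [Measure.snd, Measure.map_add _ _ measurable_snd, Measure.map_smul, Measure.map_smul]; rfl

/-- The primal objective is jointly convex as long as the product measure depends affinely on the
pair of marginals. -/
theorem transportObjective_combo_le {φ : ℝ≥0 → ℝ≥0∞} (hφ : IsEntropy φ) {C : X → X → ℝ}
    (hC : Continuous fun z : X × X => C z.1 z.2) (ε : ℝ)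
    {α α₁ α₂ β β₁ β₂ : FiniteMeasure X} {s t : ℝ≥0}
    (hα : α = s • α₁ + t • α₂) (hβ : β = s • β₁ + t • β₂)
    (hαβ : (α : Measure X).prod (β : Measure X) =
      s • (α₁ : Measure X).prod (β₁ : Measure X) + t • (α₂ : Measure X).prod (β₂ : Measure X))
    (π₁ π₂ : FiniteMeasure (X × X)) :
    transportObjective φ C ε α β (s • π₁ + t • π₂) ≤
      ((s : ℝ) : EReal) * transportObjective φ C ε α₁ β₁ π₁ +
        ((t : ℝ) : EReal) * transportObjective φ C ε α₂ β₂ π₂ := by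
  have hint : ∀ π : FiniteMeasure (X × X),
      Integrable (fun z : X × X => C z.1 z.2) (π : Measure (X × X)) := fun π =>
    hC.integrable_of_hasCompactSupport (HasCompactSupport.of_compactSpace _)
  have hcast : ((s • π₁ + t • π₂ : FiniteMeasure (X × X)) : Measure (X × X)) =
      s • (π₁ : Measure (X × X)) + t • (π₂ : Measure (X × X)) := by
    simp [FiniteMeasure.toMeasure_add, FiniteMeasure.toMeasure_smul]
  have hα' : (α : Measure X) = s • (α₁ : Measure X) + t • (α₂ : Measure X) := by
    simp [hα, FiniteMeasure.toMeasure_add, FiniteMeasure.toMeasure_smul]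
  have hβ' : (β : Measure X) = s • (β₁ : Measure X) + t • (β₂ : Measure X) := by
    simp [hβ, FiniteMeasure.toMeasure_add, FiniteMeasure.toMeasure_smul]
  have e1 : ∫ z, C z.1 z.2 ∂((s • π₁ + t • π₂ : FiniteMeasure (X × X)) : Measure (X × X)) =
      s * ∫ z, C z.1 z.2 ∂(π₁ : Measure (X × X)) + t * ∫ z, C z.1 z.2 ∂(π₂ : Measure (X × X)) := by
    rw [hcast, integral_add_measure ((hint π₁).smul_measure_nnreal)
      ((hint π₂).smul_measure_nnreal), integral_smul_nnreal_measure, integral_smul_nnreal_measure]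
    simp [NNReal.smul_def]
  have a1 := hφ.csiszarDiv_combo_le (π₁ : Measure (X × X)).fst (π₂ : Measure (X × X)).fst
    (α₁ : Measure X) (α₂ : Measure X) s t
  have a2 := hφ.csiszarDiv_combo_le (π₁ : Measure (X × X)).snd (π₂ : Measure (X × X)).snd
    (β₁ : Measure X) (β₂ : Measure X) s t
  have a3 := isEntropy_klEntropy.csiszarDiv_combo_le (π₁ : Measure (X × X)) (π₂ : Measure (X × X))
    ((α₁ : Measure X).prod (β₁ : Measure X)) ((α₂ : Measure X).prod (β₂ : Measure X)) s t
  rw [← measure_fst_combo, ← hα'] at a1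
  rw [← measure_snd_combo, ← hβ'] at a2
  rw [← hαβ] at a3
  have hc : ∀ s : ℝ≥0, ((s : ℝ) : EReal) = ((s : ℝ≥0∞) : EReal) := fun s => by
    simp [EReal.coe_nnreal_eq_coe_real]
  have hdist : ∀ (s : ℝ≥0) (c : ℝ) (E : ℝ≥0∞), ((s : ℝ) : EReal) * ((c : EReal) + (E : EReal)) =
      ((s * c : ℝ) : EReal) + ((s * E : ℝ≥0∞) : EReal) := fun s c E => by
    rw [EReal.left_distrib_of_nonneg_of_ne_top (by exact_mod_cast s.2) (by simp), EReal.coe_mul,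
      EReal.coe_ennreal_mul, hc s]
  simp only [transportObjective]
  rw [hdist, hdist, e1, EReal.coe_add, add_add_add_comm, ← EReal.coe_ennreal_add]
  refine add_le_add_right (EReal.coe_ennreal_le_coe_ennreal_iff.2 ?_) _
  rw [hcast, klDiv_eq_csiszarDiv, klDiv_eq_csiszarDiv, klDiv_eq_csiszarDiv]
  refine (add_le_add (add_le_add a1 a2) (mul_le_mul_right a3 _)).trans_eq ?_
  ring

end ConvexObjective

/-! ### Continuity of integrals in the measure and the integrand -/

section Pairing

variable {Y : Type*} [TopologicalSpace Y] [CompactSpace Y] [MeasurableSpace Y]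
  [OpensMeasurableSpace Y]

theorem ContinuousMap.integrable_finiteMeasure (u : C(Y, ℝ)) (α : FiniteMeasure Y) :
    Integrable u (α : Measure Y) :=
  (BoundedContinuousFunction.mkOfCompact u).integrable _

/-- The duality pairing between finite measures and continuous functions is jointly continuous. -/
theorem continuous_integral_finiteMeasure :
    Continuous fun z : FiniteMeasure Y × C(Y, ℝ) => ∫ x, z.2 x ∂(z.1 : Measure Y) := by
  rw [continuous_iff_continuousAt]
  rintro ⟨α₀, u₀⟩
  have h1 : ∀ z : FiniteMeasure Y × C(Y, ℝ), ∫ x, z.2 x ∂(z.1 : Measure Y) =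
      ∫ x, (z.2 - u₀) x ∂(z.1 : Measure Y) + ∫ x, u₀ x ∂(z.1 : Measure Y) := by
    intro z
    rw [← integral_add ((z.2 - u₀).integrable_finiteMeasure _) (u₀.integrable_finiteMeasure _)]
    simp
  have h2 : Tendsto (fun z : FiniteMeasure Y × C(Y, ℝ) => ∫ x, u₀ x ∂(z.1 : Measure Y))
      (𝓝 (α₀, u₀)) (𝓝 (∫ x, u₀ x ∂(α₀ : Measure Y))) :=
    (FiniteMeasure.tendsto_iff_forall_integral_tendsto.1 continuous_fst.continuousAt)
      (BoundedContinuousFunction.mkOfCompact u₀)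
  have h3 : Tendsto (fun z : FiniteMeasure Y × C(Y, ℝ) => ∫ x, (z.2 - u₀) x ∂(z.1 : Measure Y))
      (𝓝 (α₀, u₀)) (𝓝 0) := by
    -- Mass is weakly continuous, so uniform smallness of the integrand makes its integral small
    -- along varying measures.
    have hb : Tendsto (fun z : FiniteMeasure Y × C(Y, ℝ) => ‖z.2 - u₀‖ * (z.1.mass : ℝ))
        (𝓝 (α₀, u₀)) (𝓝 0) := by
      have hc : Continuous fun z : FiniteMeasure Y × C(Y, ℝ) => ‖z.2 - u₀‖ * (z.1.mass : ℝ) :=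
        (continuous_snd.sub continuous_const).norm.mul
          (NNReal.continuous_coe.comp (FiniteMeasure.continuous_mass.comp continuous_fst))
      simpa using hc.tendsto (α₀, u₀)
    refine squeeze_zero_norm (fun z => ?_) hb
    exact norm_integral_le_of_norm_le_const (Eventually.of_forall fun x =>
      (z.2 - u₀).norm_coe_le_norm x)
  have := h3.add h2
  rw [zero_add] at this
  exact this.congr fun z => (h1 z).symm

/-- Integrals of a lower semicontinuous function along continuous functions are jointly lower
semicontinuous in the measure and in the function. -/
theorem lowerSemicontinuous_lintegral_comp {ψ : ℝ → ℝ≥0∞} (hψ : LowerSemicontinuous ψ) :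
    LowerSemicontinuous fun z : FiniteMeasure Y × C(Y, ℝ) =>
      ∫⁻ x, ψ (z.2 x) ∂(z.1 : Measure Y) := by
  -- By monotone convergence the integral is a supremum of integrals of bounded continuous
  -- functions, each jointly continuous.
  obtain ⟨F, hFc, hFm, hFb, hF⟩ := hψ.exists_monotone_continuous
  have hft : ∀ k x, F k x ≠ ∞ := fun k x => ((hFb k x).trans_lt (ENNReal.natCast_lt_top k)).ne
  let Φ : ℕ → C(ℝ, ℝ) := fun k => ⟨fun x => (F k x).toReal,
    ENNReal.continuousOn_toReal.comp_continuous (hFc k) (hft k)⟩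
  have h1 : ∀ z : FiniteMeasure Y × C(Y, ℝ), ∫⁻ x, ψ (z.2 x) ∂(z.1 : Measure Y) =
      ⨆ k, ENNReal.ofReal (∫ x, (Φ k).comp z.2 x ∂(z.1 : Measure Y)) := by
    intro z
    simp_rw [← hF]
    have hm : ∀ k, Measurable fun x => F k (z.2 x) := fun k =>
      ((hFc k).comp z.2.continuous).measurable
    rw [lintegral_iSup hm (fun k l hkl x => hFm hkl _)]
    refine iSup_congr fun k => ?_
    rw [ofReal_integral_eq_lintegral_ofReal (ContinuousMap.integrable_finiteMeasure _ _)
      (Eventually.of_forall fun x => ENNReal.toReal_nonneg)]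
    refine lintegral_congr fun x => ?_
    exact (ENNReal.ofReal_toReal (hft k _)).symm
  simp_rw [h1]
  refine lowerSemicontinuous_iSup fun k => Continuous.lowerSemicontinuous ?_
  exact ENNReal.continuous_ofReal.comp (continuous_integral_finiteMeasure.comp
    (continuous_fst.prodMk ((ContinuousMap.continuous_postcomp (Φ k)).comp continuous_snd)))

/-- Integration of the second variable, as a continuous function of the first one. -/
def partialIntegral (β : FiniteMeasure Y) (F : C(Y × Y, ℝ)) : C(Y, ℝ) where
  toFun x := ∫ y, F (x, y) ∂(β : Measure Y)
  continuous_toFun := continuous_integral_finiteMeasure.comp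
    (continuous_const.prodMk F.curry.continuous)

/-- Continuity into `C(Y, ℝ)` follows from joint continuity with the evaluation point, and that is
the continuous pairing applied to the curried integrand. -/
theorem continuous_partialIntegral :
    Continuous fun z : FiniteMeasure Y × C(Y × Y, ℝ) => partialIntegral z.1 z.2 := by
  refine ContinuousMap.continuous_of_continuous_uncurry _ ?_
  have h : Continuous fun w : (FiniteMeasure Y × C(Y × Y, ℝ)) × Y => w.1.2.curry w.2 := by
    refine ContinuousMap.continuous_of_continuous_uncurry _ ?_
    simp only [Function.uncurry_def, ContinuousMap.curry_apply]
    fun_prop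
  exact continuous_integral_finiteMeasure.comp ((continuous_fst.comp continuous_fst).prodMk h)

end Pairing

/-! ### Gibbs plans and their primal value -/

section GibbsDensity

variable {X : Type*} [MetricSpace X]

/-- The Gibbs density `exp ((f ⊕ g - c) / ε)`. -/
def gibbs (c : C(X × X, ℝ)) (ε : ℝ) (f g : C(X, ℝ)) : C(X × X, ℝ) :=
  ⟨fun z => Real.exp ((f z.1 + g z.2 - c z) / ε), by fun_prop⟩

@[simp] theorem gibbs_apply (c : C(X × X, ℝ)) (ε : ℝ) (f g : C(X, ℝ)) (z : X × X) :
    gibbs c ε f g z = Real.exp ((f z.1 + g z.2 - c z) / ε) := rfl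

theorem continuous_gibbs [CompactSpace X] (c : C(X × X, ℝ)) (ε : ℝ) :
    Continuous fun w : C(X, ℝ) × C(X, ℝ) => gibbs c ε w.1 w.2 := by
  refine ContinuousMap.continuous_of_continuous_uncurry _ ?_
  change Continuous fun w : (C(X, ℝ) × C(X, ℝ)) × X × X =>
    Real.exp ((w.1.1 w.2.1 + w.1.2 w.2.2 - c w.2) / ε)
  fun_prop

end GibbsDensity

section Gibbs

variable {X : Type*} [MetricSpace X] [CompactSpace X] [MeasurableSpace X] [BorelSpace X]

theorem integral_prod_eq_partialIntegral (α β : FiniteMeasure X) (F : C(X × X, ℝ)) :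
    ∫ z, F z ∂((α : Measure X).prod (β : Measure X)) =
      ∫ x, partialIntegral β F x ∂(α : Measure X) :=
  integral_prod _ (F.integrable_finiteMeasure (α.prod β))

theorem continuous_integral_prod :
    Continuous fun z : (FiniteMeasure X × FiniteMeasure X) × C(X × X, ℝ) =>
      ∫ w, z.2 w ∂((z.1.1 : Measure X).prod (z.1.2 : Measure X)) := by
  simp_rw [integral_prod_eq_partialIntegral]
  exact continuous_integral_finiteMeasure.comp ((continuous_fst.comp continuous_fst).prodMk
    (continuous_partialIntegral.comp
      ((continuous_snd.comp continuous_fst).prodMk continuous_snd)))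

/-- The density of the first marginal of the Gibbs plan. -/
def gibbsFst (c : C(X × X, ℝ)) (ε : ℝ) (β : FiniteMeasure X) (f g : C(X, ℝ)) : C(X, ℝ) :=
  partialIntegral β (gibbs c ε f g)

/-- The density of the second marginal of the Gibbs plan. -/
def gibbsSnd (c : C(X × X, ℝ)) (ε : ℝ) (α : FiniteMeasure X) (f g : C(X, ℝ)) : C(X, ℝ) :=
  partialIntegral α ((gibbs c ε f g).comp ContinuousMap.prodSwap)

theorem gibbsFst_nonneg (c : C(X × X, ℝ)) (ε : ℝ) (β : FiniteMeasure X) (f g : C(X, ℝ)) (x : X) :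
    0 ≤ gibbsFst c ε β f g x :=
  integral_nonneg fun _ => (Real.exp_pos _).le

theorem gibbsSnd_nonneg (c : C(X × X, ℝ)) (ε : ℝ) (α : FiniteMeasure X) (f g : C(X, ℝ)) (y : X) :
    0 ≤ gibbsSnd c ε α f g y :=
  integral_nonneg fun _ => (Real.exp_pos _).le

theorem isFiniteMeasure_gibbs (c : C(X × X, ℝ)) (ε : ℝ) (α β : FiniteMeasure X) (f g : C(X, ℝ)) :
    IsFiniteMeasure (((α : Measure X).prod (β : Measure X)).withDensity
      fun z => ((gibbs c ε f g z).toNNReal : ℝ≥0∞)) :=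
  isFiniteMeasure_withDensity_ofReal
    ((gibbs c ε f g).integrable_finiteMeasure (α.prod β)).hasFiniteIntegral

/-- The Gibbs plan `exp ((f ⊕ g - c) / ε) α ⊗ β`. -/
def gibbsPlan (c : C(X × X, ℝ)) (ε : ℝ) (α β : FiniteMeasure X) (f g : C(X, ℝ)) :
    FiniteMeasure (X × X) :=
  ⟨((α : Measure X).prod (β : Measure X)).withDensity
      fun z => ((gibbs c ε f g z).toNNReal : ℝ≥0∞),
    isFiniteMeasure_gibbs c ε α β f g⟩

theorem lintegral_gibbs (c : C(X × X, ℝ)) (ε : ℝ) (β : FiniteMeasure X) (f g : C(X, ℝ)) (x : X) :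
    ∫⁻ y, (gibbs c ε f g (x, y)).toNNReal ∂(β : Measure X) =
      ((gibbsFst c ε β f g x).toNNReal : ℝ≥0∞) :=
  (ofReal_integral_eq_lintegral_ofReal
    (((gibbs c ε f g).curry x).integrable_finiteMeasure β)
    (Eventually.of_forall fun _ => (Real.exp_pos _).le)).symm

theorem lintegral_gibbs_swap (c : C(X × X, ℝ)) (ε : ℝ) (α : FiniteMeasure X) (f g : C(X, ℝ))
    (y : X) :
    ∫⁻ x, (gibbs c ε f g (x, y)).toNNReal ∂(α : Measure X) =
      ((gibbsSnd c ε α f g y).toNNReal : ℝ≥0∞) :=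
  (ofReal_integral_eq_lintegral_ofReal
    ((((gibbs c ε f g).comp ContinuousMap.prodSwap).curry y).integrable_finiteMeasure α)
    (Eventually.of_forall fun _ => (Real.exp_pos _).le)).symm

theorem measurable_gibbs_toNNReal (c : C(X × X, ℝ)) (ε : ℝ) (f g : C(X, ℝ)) :
    Measurable fun z => (gibbs c ε f g z).toNNReal :=
  (gibbs c ε f g).continuous.measurable.real_toNNReal

theorem gibbsPlan_fst (c : C(X × X, ℝ)) (ε : ℝ) (α β : FiniteMeasure X) (f g : C(X, ℝ)) :
    (gibbsPlan c ε α β f g : Measure (X × X)).fst =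
      (α : Measure X).withDensity fun x => ((gibbsFst c ε β f g x).toNNReal : ℝ≥0∞) := by
  ext s hs
  have h : (Prod.fst ⁻¹' s : Set (X × X)) = s ×ˢ Set.univ := by ext; simp
  rw [Measure.fst_apply hs, withDensity_apply _ hs, gibbsPlan, FiniteMeasure.toMeasure_mk,
    withDensity_apply _ (measurable_fst hs), h, ← Measure.prod_restrict, Measure.restrict_univ,
    lintegral_prod _ (measurable_gibbs_toNNReal c ε f g).coe_nnreal_ennreal.aemeasurable]
  simp_rw [lintegral_gibbs]

theorem gibbsPlan_snd (c : C(X × X, ℝ)) (ε : ℝ) (α β : FiniteMeasure X) (f g : C(X, ℝ)) :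
    (gibbsPlan c ε α β f g : Measure (X × X)).snd =
      (β : Measure X).withDensity fun y => ((gibbsSnd c ε α f g y).toNNReal : ℝ≥0∞) := by
  ext s hs
  have h : (Prod.snd ⁻¹' s : Set (X × X)) = Set.univ ×ˢ s := by ext; simp
  rw [Measure.snd_apply hs, withDensity_apply _ hs, gibbsPlan, FiniteMeasure.toMeasure_mk,
    withDensity_apply _ (measurable_snd hs), h, ← Measure.prod_restrict, Measure.restrict_univ,
    lintegral_prod_symm _ (measurable_gibbs_toNNReal c ε f g).coe_nnreal_ennreal.aemeasurable]
  simp_rw [lintegral_gibbs_swap]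

/-- The value of the primal objective at a Gibbs plan. -/
def primalValue (φ : ℝ≥0 → ℝ≥0∞) (c : C(X × X, ℝ)) (ε : ℝ) (α β : FiniteMeasure X)
    (f g : C(X, ℝ)) : EReal :=
  ((∫ z, (f z.1 + g z.2) * gibbs c ε f g z - ε * (gibbs c ε f g z - 1)
      ∂((α : Measure X).prod (β : Measure X)) : ℝ) : EReal) +
    ((∫⁻ x, φ (gibbsFst c ε β f g x).toNNReal ∂(α : Measure X) +
      ∫⁻ y, φ (gibbsSnd c ε α f g y).toNNReal ∂(β : Measure X) : ℝ≥0∞) : EReal)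

/-- The dual functional in terms of the shifted conjugate. -/
def dualValue (φ : ℝ≥0 → ℝ≥0∞) (c : C(X × X, ℝ)) (ε : ℝ) (α β : FiniteMeasure X)
    (f g : C(X, ℝ)) : EReal :=
  ((∫ x, f x ∂(α : Measure X) + ∫ y, g y ∂(β : Measure X) -
      ε * ∫ z, (gibbs c ε f g z - 1) ∂((α : Measure X).prod (β : Measure X)) : ℝ) : EReal) -
    ((∫⁻ x, conjGap φ (f x) ∂(α : Measure X) +
      ∫⁻ y, conjGap φ (g y) ∂(β : Measure X) : ℝ≥0∞) : EReal)

-- The logarithm of the Gibbs density `r` is `(f ⊕ g - c) / ε`, so the entropic term cancels the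
-- transport cost: `c r + ε klFun r = (f ⊕ g) r - ε (r - 1)`.
open InformationTheory in
theorem transportObjective_gibbsPlan (φ : ℝ≥0 → ℝ≥0∞) (c : C(X × X, ℝ)) {ε : ℝ} (hε : 0 < ε)
    (α β : FiniteMeasure X) (f g : C(X, ℝ)) :
    transportObjective φ (fun x y => c (x, y)) ε α β (gibbsPlan c ε α β f g) =
      primalValue φ c ε α β f g := by
  set ρ : Measure (X × X) := (α : Measure X).prod (β : Measure X)
  set r := gibbs c ε f g
  have hint : ∀ u : C(X × X, ℝ), Integrable u ρ := fun u => u.integrable_finiteMeasure (α.prod β)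
  have hrpos : ∀ z, 0 < r z := fun z => Real.exp_pos _
  have i2 : Integrable (fun z => klFun (r z)) ρ :=
    hint ((⟨klFun, continuous_klFun⟩ : C(ℝ, ℝ)).comp r)
  have hc : ∫ z, c (z.1, z.2) ∂(gibbsPlan c ε α β f g : Measure (X × X)) = ∫ z, r z * c z ∂ρ := by
    rw [gibbsPlan, FiniteMeasure.toMeasure_mk,
      integral_withDensity_eq_integral_smul (measurable_gibbs_toNNReal c ε f g)]
    refine integral_congr_ae (Eventually.of_forall fun z => ?_)
    simp only [NNReal.smul_def, smul_eq_mul]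
    rw [Real.coe_toNNReal _ (hrpos z).le]
  have hkl : klDiv (gibbsPlan c ε α β f g : Measure (X × X)) ρ =
      ENNReal.ofReal (∫ z, klFun (r z) ∂ρ) := by
    rw [klDiv_eq_csiszarDiv, gibbsPlan, FiniteMeasure.toMeasure_mk,
      csiszarDiv_withDensity _ _ (measurable_gibbs_toNNReal c ε f g),
      ofReal_integral_eq_lintegral_ofReal i2
        (Eventually.of_forall fun z => klFun_nonneg (hrpos z).le)]
    refine lintegral_congr fun z => ?_
    rw [klEntropy, Real.coe_toNNReal _ (hrpos z).le]
  have hreal : ∫ z, r z * c z ∂ρ + ε * ∫ z, klFun (r z) ∂ρ =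
      ∫ z, (f z.1 + g z.2) * r z - ε * (r z - 1) ∂ρ := by
    have i1 : Integrable (fun z => r z * c z) ρ := hint (r * c)
    rw [← integral_const_mul, ← integral_add i1 (i2.const_mul ε)]
    refine integral_congr_ae (Eventually.of_forall fun z => ?_)
    have hlog : Real.log (r z) = (f z.1 + g z.2 - c z) / ε := Real.log_exp _
    simp only [klFun_apply, hlog]
    field_simp
    ring
  rw [transportObjective, primalValue, gibbsPlan_fst, gibbsPlan_snd,
    csiszarDiv_withDensity φ _ (gibbsFst c ε β f g).continuous.measurable.real_toNNReal,
    csiszarDiv_withDensity φ _ (gibbsSnd c ε α f g).continuous.measurable.real_toNNReal, hkl, hc,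
    ← ENNReal.ofReal_mul hε.le, EReal.coe_ennreal_add _ (ENNReal.ofReal _),
    EReal.coe_ennreal_ofReal, max_eq_left (mul_nonneg hε.le
      (integral_nonneg fun z => klFun_nonneg (hrpos z).le)), ← hreal, EReal.coe_add,
    add_comm (_ : EReal) ((ε * ∫ z, klFun (r z) ∂ρ : ℝ) : EReal), add_assoc]

theorem entropicOT_le_primalValue (φ : ℝ≥0 → ℝ≥0∞) (c : C(X × X, ℝ)) {ε : ℝ} (hε : 0 < ε)
    (α β : FiniteMeasure X) (f g : C(X, ℝ)) :
    entropicOT φ (fun x y => c (x, y)) ε α β ≤ primalValue φ c ε α β f g :=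
  (iInf_le _ _).trans_eq (transportObjective_gibbsPlan φ c hε α β f g)

end Gibbs

/-! ### Extended integrals and integrated Young inequalities -/

section ExtendedIntegrals

variable {Ω : Type*} [MeasurableSpace Ω]

theorem coe_integral_le_lintegral {μ : Measure Ω} {v : Ω → ℝ} {F : Ω → ℝ≥0∞}
    (hv : Integrable v μ) (h : ∀ᵐ x ∂μ, ENNReal.ofReal (v x) ≤ F x) :
    ((∫ x, v x ∂μ : ℝ) : EReal) ≤ ((∫⁻ x, F x ∂μ : ℝ≥0∞) : EReal) := by
  have h1 : ∫ x, v x ∂μ ≤ ∫ x, max (v x) 0 ∂μ :=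
    integral_mono hv hv.pos_part fun x => le_max_left _ _
  have h2 : ENNReal.ofReal (∫ x, max (v x) 0 ∂μ) ≤ ∫⁻ x, F x ∂μ := by
    rw [ofReal_integral_eq_lintegral_ofReal hv.pos_part
      (Eventually.of_forall fun x => le_max_right _ _)]
    refine lintegral_mono_ae ?_
    filter_upwards [h] with x hx
    simpa [ENNReal.ofReal_max] using hx
  calc ((∫ x, v x ∂μ : ℝ) : EReal) ≤ ((∫ x, max (v x) 0 ∂μ : ℝ) : EReal) := by exact_mod_cast h1
    _ ≤ ((ENNReal.ofReal (∫ x, max (v x) 0 ∂μ) : ℝ≥0∞) : EReal) := by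
        rw [EReal.coe_ennreal_ofReal]; exact_mod_cast le_max_left _ _
    _ ≤ _ := EReal.coe_ennreal_le_coe_ennreal_iff.2 h2

/-- The integral of the difference of a nonnegative function and an integrable one. -/
theorem extIntegral_coe_sub {μ : Measure Ω} {G : Ω → ℝ≥0∞} (hG : Measurable G) {f : Ω → ℝ}
    (hf : Integrable f μ) (hfm : Measurable f) :
    extIntegral μ (fun x => (G x : EReal) - (f x : EReal)) =
      ((∫⁻ x, G x ∂μ : ℝ≥0∞) : EReal) - ((∫ x, f x ∂μ : ℝ) : EReal) := by
  -- Positive and negative parts are compared by an identity without subtraction, valid also where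
  -- `G x = ∞`. After integration only `G` and the positive part can be infinite, so the other terms
  -- may be moved across.
  have hA : ∀ x, ((G x : EReal) - (f x : EReal)).toENNReal + ENNReal.ofReal (f x) =
      G x + (ENNReal.ofReal (-f x) + (-((G x : EReal) - (f x : EReal))).toENNReal) := by
    intro x
    by_cases h : G x = ∞
    · simp [h]
    · lift G x to ℝ≥0 using h with a
      have ha := a.coe_nonneg
      have e : ((a : ℝ≥0∞) : EReal) = ((a : ℝ) : EReal) := rfl
      rw [e, ← EReal.coe_sub, ← EReal.coe_neg, EReal.real_coe_toENNReal, EReal.real_coe_toENNReal,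
        ← ENNReal.ofReal_coe_nnreal, ← ENNReal.toReal_eq_toReal_iff' (by simp) (by simp),
        ENNReal.toReal_add (by simp) (by simp), ENNReal.toReal_add (by simp) (by simp),
        ENNReal.toReal_add (by simp) (by simp)]
      simp only [ENNReal.toReal_ofReal']
      grind
  have hB : ∀ x, (-((G x : EReal) - (f x : EReal))).toENNReal ≤ ENNReal.ofReal (f x) := by
    intro x
    rw [← EReal.real_coe_toENNReal]
    refine EReal.toENNReal_le_toENNReal ?_
    rw [EReal.neg_sub (by simp) (by simp), add_comm, ← sub_eq_add_neg]
    exact EReal.sub_le_of_le_add (le_add_of_nonneg_right (EReal.coe_ennreal_nonneg _))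
  have hfp : ∫⁻ x, ENNReal.ofReal (f x) ∂μ ≠ ∞ := hf.lintegral_lt_top.ne
  have hfn : ∫⁻ x, ENNReal.ofReal (-f x) ∂μ ≠ ∞ := hf.neg.lintegral_lt_top.ne
  have hBt := ((lintegral_mono hB).trans_lt (lt_top_iff_ne_top.2 hfp)).ne
  have hsum := lintegral_congr (μ := μ) hA
  have m1 : Measurable fun x => ENNReal.ofReal (f x) := hfm.ennreal_ofReal
  have m2 : Measurable fun x => ENNReal.ofReal (-f x) := hfm.neg.ennreal_ofReal
  rw [lintegral_add_right _ m1, lintegral_add_left hG, lintegral_add_left m2] at hsum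
  rw [extIntegral, integral_eq_lintegral_pos_part_sub_lintegral_neg_part hf]
  generalize (∫⁻ x, ((G x : EReal) - (f x : EReal)).toENNReal ∂μ) = A at *
  generalize (∫⁻ x, (-((G x : EReal) - (f x : EReal))).toENNReal ∂μ) = B at *
  generalize (∫⁻ x, ENNReal.ofReal (f x) ∂μ) = P at *
  generalize (∫⁻ x, ENNReal.ofReal (-f x) ∂μ) = N at *
  generalize (∫⁻ x, G x ∂μ) = I at *
  lift B to ℝ≥0 using hBt
  lift P to ℝ≥0 using hfp
  lift N to ℝ≥0 using hfn
  by_cases hI : I = ∞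
  · have : A = ∞ := by
      rw [hI, top_add, ENNReal.add_eq_top] at hsum
      simpa using hsum
    rw [this, hI]
    simp only [EReal.coe_ennreal_top]
    have e : ((B : ℝ≥0∞) : EReal) = ((B : ℝ) : EReal) := rfl
    rw [e, EReal.top_sub_coe, EReal.top_sub_coe]
  · have hAt : A ≠ ∞ := by
      rintro rfl
      rw [top_add, eq_comm, ENNReal.add_eq_top] at hsum
      simp [hI] at hsum
    lift A to ℝ≥0 using hAt
    lift I to ℝ≥0 using hI
    have e : ∀ a : ℝ≥0, ((a : ℝ≥0∞) : EReal) = ((a : ℝ) : EReal) := fun _ => rfl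
    have h : (A : ℝ) + P = I + (N + B) := by exact_mod_cast hsum
    rw [e, e, e, ← EReal.coe_sub, ← EReal.coe_sub, EReal.coe_eq_coe_iff]
    simp only [ENNReal.coe_toReal]
    linarith

/-- Integrate the Fenchel–Young inequality at `p = dμ/dν` and `t = f x` against `ν`. -/
theorem integral_sub_integral_le_csiszarDiv_add {φ : ℝ≥0 → ℝ≥0∞} {μ ν : Measure Ω}
    [IsFiniteMeasure μ] [IsFiniteMeasure ν] (hμν : μ ≪ ν) {f : Ω → ℝ}
    (hφ : Measurable φ) (hf : Integrable f ν) (hf' : Integrable f μ) :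
    ((∫ x, f x ∂ν - ∫ x, f x ∂μ : ℝ) : EReal) ≤
      ((csiszarDiv φ μ ν + ∫⁻ x, conjGap φ (f x) ∂ν : ℝ≥0∞) : EReal) := by
  have hint : Integrable (fun x => (μ.rnDeriv ν x).toReal • f x) ν :=
    (integrable_rnDeriv_smul_iff hμν).2 hf'
  rw [← integral_rnDeriv_smul hμν, ← integral_sub hf hint]
  have hm : Measurable fun x => φ (μ.rnDeriv ν x).toNNReal :=
    hφ.comp (Measure.measurable_rnDeriv _ _).ennreal_toNNReal
  refine (coe_integral_le_lintegral (hf.sub hint)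
    (F := fun x => φ (μ.rnDeriv ν x).toNNReal + conjGap φ (f x))
    (Eventually.of_forall fun x => ?_)).trans ?_
  · convert ofReal_le_add_conjGap φ (μ.rnDeriv ν x).toNNReal (f x) using 2
    simp only [Pi.sub_apply, smul_eq_mul, ENNReal.coe_toNNReal_eq_toReal]
    ring
  · rw [EReal.coe_ennreal_le_coe_ennreal_iff, lintegral_add_left hm, csiszarDiv]
    gcongr
    exact le_self_add

open InformationTheory in
/-- Young's inequality for the entropy `klFun`. -/
theorem mul_le_klFun_add_exp_sub_one {r : ℝ} (hr : 0 ≤ r) (u : ℝ) :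
    r * u ≤ klFun r + (Real.exp u - 1) := by
  rw [klFun_apply]
  rcases hr.eq_or_lt with rfl | hr
  · simpa using (Real.exp_pos u).le
  · have h1 : Real.exp u = r * Real.exp (u - Real.log r) := by
      rw [Real.exp_sub, Real.exp_log hr]; field_simp
    have h2 := mul_le_mul_of_nonneg_left (Real.add_one_le_exp (u - Real.log r)) hr.le
    linarith

open InformationTheory in
/-- The variational lower bound of the Kullback–Leibler divergence. -/
theorem integral_sub_integral_exp_le_klDiv {π ρ : Measure Ω} [IsFiniteMeasure π]
    [IsFiniteMeasure ρ] {u : Ω → ℝ} (hu : Integrable u π)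
    (hexp : Integrable (fun z => Real.exp (u z) - 1) ρ) :
    ((∫ z, u z ∂π - ∫ z, (Real.exp (u z) - 1) ∂ρ : ℝ) : EReal) ≤ ((klDiv π ρ : ℝ≥0∞) : EReal) := by
  by_cases hac : π ≪ ρ
  · have hint : Integrable (fun x => (π.rnDeriv ρ x).toReal • u x) ρ :=
      (integrable_rnDeriv_smul_iff hac).2 hu
    rw [← integral_rnDeriv_smul hac, ← integral_sub hint hexp, klDiv_eq_lintegral_klFun_of_ac hac]
    refine coe_integral_le_lintegral (hint.sub hexp) (Eventually.of_forall fun x =>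
      ENNReal.ofReal_le_ofReal ?_)
    have := mul_le_klFun_add_exp_sub_one (ENNReal.toReal_nonneg (a := π.rnDeriv ρ x)) (u x)
    simp only [smul_eq_mul]
    linarith
  · rw [klDiv_of_not_ac hac]
    simp

end ExtendedIntegrals

/-! ### Weak duality and semicontinuity of the two bounds -/

section Duality

variable {X : Type*} [MetricSpace X] [CompactSpace X] [MeasurableSpace X] [BorelSpace X]

theorem extIntegral_entropyConj_neg {φ : ℝ≥0 → ℝ≥0∞} (h1 : φ 1 = 0) (α : FiniteMeasure X)
    (f : C(X, ℝ)) :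
    extIntegral (α : Measure X) (fun x => entropyConj φ (-f x)) =
      ((∫⁻ x, conjGap φ (f x) ∂(α : Measure X) : ℝ≥0∞) : EReal) -
        ((∫ x, f x ∂(α : Measure X) : ℝ) : EReal) := by
  simp_rw [entropyConj_neg h1]
  exact extIntegral_coe_sub ((lowerSemicontinuous_conjGap φ).measurable.comp
    f.continuous.measurable) (f.integrable_finiteMeasure α) f.continuous.measurable

/-- The shifted conjugate separates the integrals into one real number and one subtracted element of
`ℝ≥0∞`, which rules out any `∞ - ∞`. -/
theorem dualFunctional_eq_dualValue {φ : ℝ≥0 → ℝ≥0∞} (h1 : φ 1 = 0) (c : C(X × X, ℝ)) (ε : ℝ)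
    (α β : FiniteMeasure X) (f g : C(X, ℝ)) :
    dualFunctional φ (fun x y => c (x, y)) ε α β f g = dualValue φ c ε α β f g := by
  rw [dualFunctional, dualValue, extIntegral_entropyConj_neg h1, extIntegral_entropyConj_neg h1]
  simp only [gibbs_apply]
  generalize (∫⁻ x, conjGap φ (f x) ∂(α : Measure X)) = A
  generalize (∫⁻ x, conjGap φ (g x) ∂(β : Measure X)) = B
  generalize (∫ x, f x ∂(α : Measure X)) = a
  generalize (∫ x, g x ∂(β : Measure X)) = b
  generalize (ε * ∫ z, (Real.exp ((f z.1 + g z.2 - c z) / ε) - 1)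
    ∂((α : Measure X).prod (β : Measure X))) = k
  by_cases hA : A = ∞
  · simp [hA, sub_eq_add_neg, ← EReal.coe_neg]
  by_cases hB : B = ∞
  · simp [hB, sub_eq_add_neg, ← EReal.coe_neg]
  lift A to ℝ≥0 using hA
  lift B to ℝ≥0 using hB
  have e : ∀ a : ℝ≥0, ((a : ℝ≥0∞) : EReal) = ((a : ℝ) : EReal) := fun _ => rfl
  rw [← ENNReal.coe_add, e, e, e, ← EReal.coe_sub, ← EReal.coe_sub, ← EReal.coe_neg,
    ← EReal.coe_sub, ← EReal.coe_sub, ← EReal.coe_sub, EReal.coe_eq_coe_iff]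
  push_cast
  ring

theorem absolutelyContinuous_fst_of_prod {Ω Ω' : Type*} [MeasurableSpace Ω] [MeasurableSpace Ω']
    {π : Measure (Ω × Ω')} {μ : Measure Ω} {ν : Measure Ω'} [SFinite ν] (h : π ≪ μ.prod ν) :
    π.fst ≪ μ :=
  (h.map measurable_fst).trans Measure.quasiMeasurePreserving_fst.absolutelyContinuous

theorem absolutelyContinuous_snd_of_prod {Ω Ω' : Type*} [MeasurableSpace Ω] [MeasurableSpace Ω']
    {π : Measure (Ω × Ω')} {μ : Measure Ω} {ν : Measure Ω'} [SFinite ν] (h : π ≪ μ.prod ν) :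
    π.snd ≪ ν :=
  (h.map measurable_snd).trans Measure.quasiMeasurePreserving_snd.absolutelyContinuous

open InformationTheory in
/-- Weak duality. -/
theorem IsEntropy.dualValue_le_transportObjective {φ : ℝ≥0 → ℝ≥0∞} (hφ : IsEntropy φ)
    (c : C(X × X, ℝ)) {ε : ℝ} (hε : 0 < ε) (α β : FiniteMeasure X) (f g : C(X, ℝ))
    (π : FiniteMeasure (X × X)) :
    dualValue φ c ε α β f g ≤ transportObjective φ (fun x y => c (x, y)) ε α β π := by
  set P : Measure (X × X) := (π : Measure (X × X))
  set ρ : Measure (X × X) := (α : Measure X).prod (β : Measure X)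
  -- Otherwise the KL term, hence the objective, is infinite. Absolute continuity passes to the
  -- marginals and makes their Fenchel–Young bounds available.
  by_cases hac : P ≪ ρ
  swap
  · rw [transportObjective, klDiv_of_not_ac hac, ENNReal.mul_top (by simpa using hε)]
    simp
  have hintP : ∀ u : C(X × X, ℝ), Integrable u P := fun u => u.integrable_finiteMeasure π
  have hintρ : ∀ u : C(X × X, ℝ), Integrable u ρ := fun u => u.integrable_finiteMeasure (α.prod β)
  have hfst : ∀ u : C(X, ℝ), ∫ x, u x ∂P.fst = ∫ z, u z.1 ∂P := fun u =>
    integral_map measurable_fst.aemeasurable u.continuous.aestronglyMeasurable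
  have hsnd : ∀ u : C(X, ℝ), ∫ x, u x ∂P.snd = ∫ z, u z.2 ∂P := fun u =>
    integral_map measurable_snd.aemeasurable u.continuous.aestronglyMeasurable
  have h1 := integral_sub_integral_le_csiszarDiv_add (absolutelyContinuous_fst_of_prod hac)
    hφ.measurable (f.integrable_finiteMeasure α)
    (f.integrable_finiteMeasure ⟨P.fst, inferInstance⟩)
  have h2 := integral_sub_integral_le_csiszarDiv_add (absolutelyContinuous_snd_of_prod hac)
    hφ.measurable (g.integrable_finiteMeasure β)
    (g.integrable_finiteMeasure ⟨P.snd, inferInstance⟩)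
  let u : C(X × X, ℝ) := ⟨fun z => (f z.1 + g z.2 - c z) / ε, by fun_prop⟩
  have h3 := integral_sub_integral_exp_le_klDiv (hintP u) (hintρ (gibbs c ε f g - 1))
  have h3' : ((ε * (∫ z, u z ∂P - ∫ z, (gibbs c ε f g z - 1) ∂ρ) : ℝ) : EReal) ≤
      ((ENNReal.ofReal ε * klDiv P ρ : ℝ≥0∞) : EReal) := by
    rw [EReal.coe_mul, EReal.coe_ennreal_mul, EReal.coe_ennreal_ofReal, max_eq_left hε.le]
    exact mul_le_mul_of_nonneg_left h3 (by exact_mod_cast hε.le)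
  have hu : ε * ∫ z, u z ∂P = ∫ x, f x ∂P.fst + ∫ y, g y ∂P.snd - ∫ z, c z ∂P := by
    have i1 : Integrable (fun z : X × X => f z.1) P := hintP (f.comp ContinuousMap.fst)
    have i2 : Integrable (fun z : X × X => g z.2) P := hintP (g.comp ContinuousMap.snd)
    have i3 : Integrable (fun z : X × X => f z.1 + g z.2) P := i1.add i2
    rw [hfst, hsnd, ← integral_add i1 i2, ← integral_sub i3 (hintP c),
      ← integral_const_mul]
    refine integral_congr_ae (Eventually.of_forall fun z => ?_)
    simp only [u, ContinuousMap.coe_mk]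
    field_simp
  -- In the sum of the three Young inequalities the integrals of `f` and `g` against the marginals
  -- of `π` cancel, leaving the dual value without its penalties, minus `∫ c dπ`.
  have hsum := add_le_add (add_le_add h1 h2) h3'
  rw [← EReal.coe_add, ← EReal.coe_add, ← EReal.coe_ennreal_add, ← EReal.coe_ennreal_add] at hsum
  rw [dualValue, transportObjective,
    EReal.sub_le_iff_le_add (.inl (EReal.coe_ennreal_ne_bot _)) (.inr (EReal.add_ne_bot_iff.2
      ⟨EReal.coe_ne_bot _, EReal.coe_ennreal_ne_bot _⟩))]
  have hsum' := add_le_add_right hsum ((∫ z, c z ∂P : ℝ) : EReal)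
  rw [← EReal.coe_add] at hsum'
  refine (le_of_eq ?_).trans (hsum'.trans (le_of_eq ?_))
  · rw [EReal.coe_eq_coe_iff, mul_sub, hu]
    ring
  · rw [add_assoc (_ : EReal), ← EReal.coe_ennreal_add]
    congr 2
    simp only [P, ρ]
    ring

theorem IsEntropy.dualValue_le_entropicOT {φ : ℝ≥0 → ℝ≥0∞} (hφ : IsEntropy φ)
    (c : C(X × X, ℝ)) {ε : ℝ} (hε : 0 < ε) (α β : FiniteMeasure X) (f g : C(X, ℝ)) :
    dualValue φ c ε α β f g ≤ entropicOT φ (fun x y => c (x, y)) ε α β :=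
  le_iInf fun π => hφ.dualValue_le_transportObjective c hε α β f g π

/-- Zero potentials have no conjugate penalty and give a real lower bound. -/
theorem IsEntropy.entropicOT_ne_bot {φ : ℝ≥0 → ℝ≥0∞} (hφ : IsEntropy φ)
    (c : C(X × X, ℝ)) {ε : ℝ} (hε : 0 < ε) (α β : FiniteMeasure X) :
    entropicOT φ (fun x y => c (x, y)) ε α β ≠ ⊥ := by
  refine ne_bot_of_le_ne_bot ?_ (hφ.dualValue_le_entropicOT c hε α β 0 0)
  simp only [dualValue, ContinuousMap.zero_apply, conjGap_zero, lintegral_zero, add_zero,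
    EReal.coe_ennreal_zero, sub_zero]
  exact EReal.coe_ne_bot _

/-- The real integral and the marginal densities depend continuously on measures and potentials, the
densities even uniformly. Only `φ` is merely lower semicontinuous. -/
theorem lowerSemicontinuous_primalValue {φ : ℝ≥0 → ℝ≥0∞} (hφ : LowerSemicontinuous φ)
    (c : C(X × X, ℝ)) (ε : ℝ) :
    LowerSemicontinuous fun z : (FiniteMeasure X × FiniteMeasure X) × C(X, ℝ) × C(X, ℝ) =>
      primalValue φ c ε z.1.1 z.1.2 z.2.1 z.2.2 := by
  have hg : Continuous fun z : (FiniteMeasure X × FiniteMeasure X) × C(X, ℝ) × C(X, ℝ) =>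
      gibbs c ε z.2.1 z.2.2 := (continuous_gibbs c ε).comp continuous_snd
  have hψ : LowerSemicontinuous fun t : ℝ => φ t.toNNReal :=
    hφ.comp continuous_real_toNNReal
  unfold primalValue
  refine LowerSemicontinuous.add' ?_ ?_ fun z => EReal.continuousAt_add
    (.inl (EReal.coe_ne_top _)) (.inl (EReal.coe_ne_bot _))
  · refine Continuous.lowerSemicontinuous (continuous_coe_real_ereal.comp ?_)
    let A : C(X, ℝ) × C(X, ℝ) → C(X × X, ℝ) := fun w =>
      (w.1.comp ContinuousMap.fst + w.2.comp ContinuousMap.snd) * gibbs c ε w.1 w.2 -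
        ε • (gibbs c ε w.1 w.2 - 1)
    have hA : Continuous A := by
      have := continuous_gibbs c ε
      have h1 : Continuous fun w : C(X, ℝ) × C(X, ℝ) =>
          w.1.comp (ContinuousMap.fst : C(X × X, X)) :=
        (ContinuousMap.continuous_precomp _).comp continuous_fst
      have h2 : Continuous fun w : C(X, ℝ) × C(X, ℝ) =>
          w.2.comp (ContinuousMap.snd : C(X × X, X)) :=
        (ContinuousMap.continuous_precomp _).comp continuous_snd
      exact ((h1.add h2).mul this).sub ((this.sub continuous_const).const_smul ε)
    exact continuous_integral_prod.comp (continuous_fst.prodMk (hA.comp continuous_snd))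
  · refine Continuous.comp_lowerSemicontinuous continuous_coe_ennreal_ereal ?_
      EReal.coe_ennreal_strictMono.monotone
    refine LowerSemicontinuous.add ?_ ?_
    · exact (lowerSemicontinuous_lintegral_comp hψ).comp
        ((continuous_fst.comp continuous_fst).prodMk (continuous_partialIntegral.comp
          ((continuous_snd.comp continuous_fst).prodMk hg)))
    · exact (lowerSemicontinuous_lintegral_comp hψ).comp
        ((continuous_snd.comp continuous_fst).prodMk (continuous_partialIntegral.comp
          ((continuous_fst.comp continuous_fst).prodMk
            ((ContinuousMap.continuous_precomp ContinuousMap.prodSwap).comp hg))))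

/-- The only discontinuous terms are the integrals of `conjGap φ`, lower semicontinuous and
subtracted. -/
theorem upperSemicontinuous_dualValue (φ : ℝ≥0 → ℝ≥0∞) (c : C(X × X, ℝ)) (ε : ℝ) :
    UpperSemicontinuous fun z : (FiniteMeasure X × FiniteMeasure X) × C(X, ℝ) × C(X, ℝ) =>
      dualValue φ c ε z.1.1 z.1.2 z.2.1 z.2.2 := by
  have hg : Continuous fun z : (FiniteMeasure X × FiniteMeasure X) × C(X, ℝ) × C(X, ℝ) =>
      gibbs c ε z.2.1 z.2.2 := (continuous_gibbs c ε).comp continuous_snd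
  unfold dualValue
  simp_rw [sub_eq_add_neg (_ : EReal)]
  refine UpperSemicontinuous.add' ?_ ?_ fun z => EReal.continuousAt_add
    (.inl (EReal.coe_ne_top _)) (.inl (EReal.coe_ne_bot _))
  · refine Continuous.upperSemicontinuous (continuous_coe_real_ereal.comp ?_)
    refine Continuous.sub (Continuous.add ?_ ?_) (Continuous.mul continuous_const ?_)
    · exact continuous_integral_finiteMeasure.comp
        ((continuous_fst.comp continuous_fst).prodMk (continuous_fst.comp continuous_snd))
    · exact continuous_integral_finiteMeasure.comp
        ((continuous_snd.comp continuous_fst).prodMk (continuous_snd.comp continuous_snd))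
    · exact continuous_integral_prod.comp (continuous_fst.prodMk
        (hg.sub (continuous_const (y := (1 : C(X × X, ℝ))))))
  · refine Continuous.comp_lowerSemicontinuous_antitone
      (g := fun a : ℝ≥0∞ => -(a : EReal)) (continuous_coe_ennreal_ereal.neg) ?_
      fun a b hab => EReal.neg_le_neg_iff.2 (EReal.coe_ennreal_strictMono.monotone hab)
    have hψ := lowerSemicontinuous_conjGap φ
    refine LowerSemicontinuous.add ?_ ?_
    · exact (lowerSemicontinuous_lintegral_comp hψ).comp
        ((continuous_fst.comp continuous_fst).prodMk (continuous_fst.comp continuous_snd))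
    · exact (lowerSemicontinuous_lintegral_comp hψ).comp
        ((continuous_snd.comp continuous_fst).prodMk (continuous_snd.comp continuous_snd))

end Duality

/-! ### Fenchel–Young equality as a certificate of no duality gap -/

/-- Equality in the Fenchel–Young inequality, in terms of the shifted conjugate. -/
structure IsConjPair (φ : ℝ≥0 → ℝ≥0∞) (p : ℝ≥0) (t : ℝ) : Prop where
  ne_top : φ p ≠ ∞
  gap_ne_top : conjGap φ t ≠ ∞
  eq : (φ p).toReal + (conjGap φ t).toReal = (1 - p) * t

theorem one_sub_mul_le_toReal_add {φ : ℝ≥0 → ℝ≥0∞} {p : ℝ≥0} {t : ℝ} (hp : φ p ≠ ∞)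
    (ht : conjGap φ t ≠ ∞) : (1 - p) * t ≤ (φ p).toReal + (conjGap φ t).toReal := by
  rw [← ENNReal.toReal_add hp ht]
  exact (ENNReal.ofReal_le_iff_le_toReal (ENNReal.add_ne_top.2 ⟨hp, ht⟩)).1
    (ofReal_le_add_conjGap φ p t)

namespace IsConjPair

variable {φ : ℝ≥0 → ℝ≥0∞}

/-- Monotonicity of the subdifferential. -/
theorem mul_nonpos {p₁ p₂ : ℝ≥0} {t₁ t₂ : ℝ} (h₁ : IsConjPair φ p₁ t₁) (h₂ : IsConjPair φ p₂ t₂) :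
    ((p₁ : ℝ) - p₂) * (t₁ - t₂) ≤ 0 := by
  have a := one_sub_mul_le_toReal_add h₁.ne_top h₂.gap_ne_top
  have b := one_sub_mul_le_toReal_add h₂.ne_top h₁.gap_ne_top
  have c := h₁.eq
  have d := h₂.eq
  linarith

theorem add_eq_ofReal {p : ℝ≥0} {t : ℝ} (h : IsConjPair φ p t) :
    φ p + conjGap φ t = ENNReal.ofReal ((1 - p) * t) := by
  rw [← h.eq, ENNReal.ofReal_add ENNReal.toReal_nonneg ENNReal.toReal_nonneg,
    ENNReal.ofReal_toReal h.ne_top, ENNReal.ofReal_toReal h.gap_ne_top]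

theorem nonneg {p : ℝ≥0} {t : ℝ} (h : IsConjPair φ p t) : 0 ≤ (1 - p) * t := by
  rw [← h.eq]; positivity

end IsConjPair

section Certificate

variable {X : Type*} [MetricSpace X] [CompactSpace X] [MeasurableSpace X] [BorelSpace X]
  {φ : ℝ≥0 → ℝ≥0∞}

theorem lintegral_add_lintegral_of_isConjPair (hφ : Measurable φ) {α : FiniteMeasure X}
    {p f : C(X, ℝ)} (hp : ∀ x, 0 ≤ p x)
    (h : ∀ᵐ x ∂(α : Measure X), IsConjPair φ (p x).toNNReal (f x)) :
    ∫⁻ x, φ (p x).toNNReal ∂(α : Measure X) + ∫⁻ x, conjGap φ (f x) ∂(α : Measure X) =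
      ENNReal.ofReal (∫ x, (1 - p x) * f x ∂(α : Measure X)) ∧
    0 ≤ ∫ x, (1 - p x) * f x ∂(α : Measure X) := by
  have hnn : ∀ᵐ x ∂(α : Measure X), 0 ≤ (1 - p x) * f x := by
    filter_upwards [h] with x hx
    simpa [hp x] using hx.nonneg
  refine ⟨?_, integral_nonneg_of_ae hnn⟩
  have hm : Measurable fun x => φ (p x).toNNReal := hφ.comp p.continuous.measurable.real_toNNReal
  have hint : Integrable (fun x => (1 - p x) * f x) (α : Measure X) :=
    ((1 - p) * f).integrable_finiteMeasure α
  rw [← lintegral_add_left hm, ofReal_integral_eq_lintegral_ofReal hint hnn]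
  refine lintegral_congr_ae ?_
  filter_upwards [h] with x hx
  simpa [hp x] using hx.add_eq_ofReal

theorem integral_one_sub_mul (α : FiniteMeasure X) (p u : C(X, ℝ)) :
    ∫ x, (1 - p x) * u x ∂(α : Measure X) =
      ∫ x, u x ∂(α : Measure X) - ∫ x, u x * p x ∂(α : Measure X) := by
  have h : Integrable (fun x => u x * p x) (α : Measure X) := (u * p).integrable_finiteMeasure α
  rw [← integral_sub (u.integrable_finiteMeasure α) h]
  refine integral_congr_ae (Eventually.of_forall fun x => ?_)
  simp only
  ring

theorem integral_fst_mul_gibbs (c : C(X × X, ℝ)) (ε : ℝ) (α β : FiniteMeasure X) (f g u : C(X, ℝ)) :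
    ∫ z, u z.1 * gibbs c ε f g z ∂((α : Measure X).prod (β : Measure X)) =
      ∫ x, u x * gibbsFst c ε β f g x ∂(α : Measure X) := by
  have := integral_prod_eq_partialIntegral α β ((u.comp ContinuousMap.fst) * gibbs c ε f g)
  refine this.trans (integral_congr_ae (Eventually.of_forall fun x => ?_))
  exact integral_const_mul (μ := (β : Measure X)) (u x) fun y => gibbs c ε f g (x, y)

theorem integral_snd_mul_gibbs (c : C(X × X, ℝ)) (ε : ℝ) (α β : FiniteMeasure X) (f g u : C(X, ℝ)) :
    ∫ z, u z.2 * gibbs c ε f g z ∂((α : Measure X).prod (β : Measure X)) =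
      ∫ y, u y * gibbsSnd c ε α f g y ∂(β : Measure X) := by
  have h := integral_prod_symm (μ := (α : Measure X)) (ν := (β : Measure X))
    (fun z => u z.2 * gibbs c ε f g z)
    (((u.comp ContinuousMap.snd) * gibbs c ε f g).integrable_finiteMeasure (α.prod β))
  refine h.trans (integral_congr_ae (Eventually.of_forall fun x => ?_))
  exact integral_const_mul (μ := (α : Measure X)) (u x) fun y => gibbs c ε f g (y, x)

/-- Fenchel–Young equality of the marginals of the Gibbs plan certifies the absence of a duality
gap. -/
theorem primalValue_le_dualValue_of_isConjPair (hφ : Measurable φ) (c : C(X × X, ℝ)) (ε : ℝ)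
    (α β : FiniteMeasure X) (f g : C(X, ℝ))
    (hf : ∀ᵐ x ∂(α : Measure X), IsConjPair φ (gibbsFst c ε β f g x).toNNReal (f x))
    (hg : ∀ᵐ y ∂(β : Measure X), IsConjPair φ (gibbsSnd c ε α f g y).toNNReal (g y)) :
    primalValue φ c ε α β f g ≤ dualValue φ c ε α β f g := by
  obtain ⟨h1, h1'⟩ := lintegral_add_lintegral_of_isConjPair hφ (gibbsFst_nonneg c ε β f g) hf
  obtain ⟨h2, h2'⟩ := lintegral_add_lintegral_of_isConjPair hφ (gibbsSnd_nonneg c ε α f g) hg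
  set ρ : Measure (X × X) := (α : Measure X).prod (β : Measure X)
  have hint : ∀ u : C(X × X, ℝ), Integrable u ρ := fun u => u.integrable_finiteMeasure (α.prod β)
  -- The marginals of the Gibbs plan appear here. With marginal density `p` for `f`, the difference
  -- of the primal and dual values is the integral of `φ(p) + conjGap φ f - (1 - p) f` plus its
  -- analogue for `g`.
  have hκ : ∫ z, (f z.1 + g z.2) * gibbs c ε f g z - ε * (gibbs c ε f g z - 1) ∂ρ =
      ∫ x, f x * gibbsFst c ε β f g x ∂(α : Measure X) +
      ∫ y, g y * gibbsSnd c ε α f g y ∂(β : Measure X) - ε * ∫ z, (gibbs c ε f g z - 1) ∂ρ := by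
    have i1 : Integrable (fun z : X × X => f z.1 * gibbs c ε f g z) ρ :=
      hint (f.comp ContinuousMap.fst * gibbs c ε f g)
    have i2 : Integrable (fun z : X × X => g z.2 * gibbs c ε f g z) ρ :=
      hint (g.comp ContinuousMap.snd * gibbs c ε f g)
    have i3 : Integrable (fun z : X × X => ε * (gibbs c ε f g z - 1)) ρ :=
      (hint (gibbs c ε f g - 1)).const_mul ε
    simp_rw [add_mul]
    have i12 : Integrable (fun z : X × X => f z.1 * gibbs c ε f g z + g z.2 * gibbs c ε f g z) ρ :=
      i1.add i2
    rw [integral_sub i12 i3, integral_add i1 i2, integral_const_mul,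
      integral_fst_mul_gibbs, integral_snd_mul_gibbs]
  have e1 := integral_one_sub_mul α (gibbsFst c ε β f g) f
  have e2 := integral_one_sub_mul β (gibbsSnd c ε α f g) g
  rw [primalValue, dualValue, hκ,
    EReal.le_sub_iff_add_le (.inl (EReal.coe_ennreal_ne_bot _)) (.inr (EReal.coe_ne_top _)),
    add_assoc (_ : EReal), ← EReal.coe_ennreal_add, add_add_add_comm, h1, h2, e1, e2,
    ← ENNReal.ofReal_add (by rwa [e1] at h1') (by rwa [e2] at h2'), EReal.coe_ennreal_ofReal,
    max_eq_left (by rw [e1] at h1'; rw [e2] at h2'; positivity), ← EReal.coe_add]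
  refine EReal.coe_le_coe_iff.2 (le_of_eq ?_)
  ring

theorem IsEntropy.entropicOT_eq_dualValue (hφ : IsEntropy φ) (c : C(X × X, ℝ)) {ε : ℝ} (hε : 0 < ε)
    (α β : FiniteMeasure X) (f g : C(X, ℝ))
    (h : primalValue φ c ε α β f g ≤ dualValue φ c ε α β f g) :
    entropicOT φ (fun x y => c (x, y)) ε α β = dualValue φ c ε α β f g :=
  le_antisymm ((entropicOT_le_primalValue φ c hε α β f g).trans h)
    (hφ.dualValue_le_entropicOT c hε α β f g)

end Certificate

/-! ### Optimality conditions for the dual problem -/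

section Optimality

variable {X : Type*} [MetricSpace X] {φ : ℝ≥0 → ℝ≥0∞}

/-- A continuous selection of almost optimal dual potentials. -/
theorem IsEntropy.exists_continuous_almost_conj (hφ : IsEntropy φ) (p : X → ℝ≥0) (hp : Continuous p)
    (w : X → ℝ) (hw : Continuous w) (hwφ : ∀ x, w x < 0 ∨ ENNReal.ofReal (w x) < φ (p x)) :
    ∃ h : C(X, ℝ), ∀ x, ∃ G : ℝ, 0 ≤ G ∧ conjGap φ (h x) ≤ ENNReal.ofReal G ∧
      w x + G < (1 - p x) * h x := by
  -- Admissible values at `x` form a convex set, and a value admissible at `x` stays so nearby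
  -- because the inequality is strict and `p`, `w` are continuous. A partition of unity glues local
  -- constants.
  refine exists_continuous_forall_mem_convex_of_local_const
    (t := fun x => {t : ℝ | ∃ G : ℝ, 0 ≤ G ∧ conjGap φ t ≤ ENNReal.ofReal G ∧
      w x + G < (1 - p x) * t}) (fun x => ?_) fun x => ?_
  · rintro t₁ ⟨G₁, hG₁, h₁, hl₁⟩ t₂ ⟨G₂, hG₂, h₂, hl₂⟩ a b ha hb hab
    refine ⟨a * G₁ + b * G₂, by positivity, conjGap_combo_le hG₁ hG₂ ha hb hab h₁ h₂, ?_⟩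
    have e : w x = a * w x + b * w x := by rw [← add_mul, hab, one_mul]
    simp only [smul_eq_mul]
    rcases ha.eq_or_lt with rfl | ha'
    · have hb1 : b = 1 := by simpa using hab
      subst hb1
      linarith
    · nlinarith [mul_lt_mul_of_pos_left hl₁ ha', mul_le_mul_of_nonneg_left hl₂.le hb]
  · obtain ⟨t, G, hG, htG, hlt⟩ := hφ.exists_conjGap_lt (hwφ x)
    refine ⟨t, ?_⟩
    have hc : Continuous fun y => (1 - (p y : ℝ)) * t - (w y + G) := by fun_prop
    filter_upwards [hc.continuousAt.eventually (lt_mem_nhds (show 0 < _ by linarith))] with y hy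
    exact ⟨G, hG, htG, by linarith⟩

variable [MeasurableSpace X]

/-- An infinite penalty would give dual value `-∞`, below the real value at the zero potentials. -/
theorem conjGap_lintegral_ne_top_of_optimal [OpensMeasurableSpace X]
    {c : C(X × X, ℝ)} {ε : ℝ} {α β : FiniteMeasure X}
    {f g : C(X, ℝ)} (h : dualValue φ c ε α β 0 0 ≤ dualValue φ c ε α β f g) :
    ∫⁻ x, conjGap φ (f x) ∂(α : Measure X) ≠ ∞ ∧ ∫⁻ y, conjGap φ (g y) ∂(β : Measure X) ≠ ∞ := by
  rw [← ENNReal.add_ne_top]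
  intro htop
  have h0 : dualValue φ c ε α β f g = ⊥ := by
    rw [dualValue, htop]
    exact EReal.sub_top _
  rw [h0, le_bot_iff] at h
  simp only [dualValue, ContinuousMap.zero_apply, conjGap_zero, lintegral_zero, add_zero,
    EReal.coe_ennreal_zero, sub_zero] at h
  exact EReal.coe_ne_bot _ h

variable [CompactSpace X] [BorelSpace X]

/-- First-order optimality condition of the dual problem in its first variable. -/
theorem gap_sub_le_of_optimal {c : C(X × X, ℝ)} {ε : ℝ} (hε : 0 < ε) {α β : FiniteMeasure X}
    {f g : C(X, ℝ)} (hG : ∫⁻ x, conjGap φ (f x) ∂(α : Measure X) ≠ ∞)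
    (hGg : ∫⁻ y, conjGap φ (g y) ∂(β : Measure X) ≠ ∞)
    (hopt : ∀ h : C(X, ℝ), dualValue φ c ε α β h g ≤ dualValue φ c ε α β f g)
    (h : C(X, ℝ)) (hGh : ∫⁻ x, conjGap φ (h x) ∂(α : Measure X) ≠ ∞) :
    (∫⁻ x, conjGap φ (f x) ∂(α : Measure X)).toReal -
        ∫ x, (1 - gibbsFst c ε β f g x) * f x ∂(α : Measure X) ≤
      (∫⁻ x, conjGap φ (h x) ∂(α : Measure X)).toReal -
        ∫ x, (1 - gibbsFst c ε β f g x) * h x ∂(α : Measure X) := by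
  set ρ : Measure (X × X) := (α : Measure X).prod (β : Measure X)
  have hint : ∀ u : C(X × X, ℝ), Integrable u ρ := fun u => u.integrable_finiteMeasure (α.prod β)
  have ia : ∀ u : C(X, ℝ), Integrable u (α : Measure X) := fun u => u.integrable_finiteMeasure α
  set G : C(X, ℝ) → ℝ≥0∞ := fun u => ∫⁻ x, conjGap φ (u x) ∂(α : Measure X) with hGdef
  set r := gibbs c ε f g
  set p := gibbsFst c ε β f g
  set d : C(X, ℝ) := h - f with hd
  -- comparison of the dual values along the segment
  have hreal : ∀ u : C(X, ℝ), G u ≠ ∞ →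
      ∫ x, u x ∂(α : Measure X) - ε * ∫ z, (gibbs c ε u g z - 1) ∂ρ - (G u).toReal ≤
      ∫ x, f x ∂(α : Measure X) - ε * ∫ z, (r z - 1) ∂ρ - (G f).toReal := by
    intro u hu
    have := hopt u
    have e : ∀ v : ℝ≥0∞, v ≠ ∞ → (v : EReal) = ((v.toReal : ℝ) : EReal) := fun v hv => by
      lift v to ℝ≥0 using hv; rfl
    rw [dualValue, dualValue, e _ (ENNReal.add_ne_top.2 ⟨hu, hGg⟩),
      e _ (ENNReal.add_ne_top.2 ⟨hG, hGg⟩), ← EReal.coe_sub, ← EReal.coe_sub,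
      EReal.coe_le_coe_iff, ENNReal.toReal_add hu hGg, ENNReal.toReal_add hG hGg] at this
    linarith
  have hseg : ∀ s : ℝ, 0 < s → s ≤ 1 → G (f + s • d) ≠ ∞ ∧
      (G (f + s • d)).toReal ≤ (1 - s) * (G f).toReal + s * (G h).toReal := by
    intro s hs hs1
    have hle : G (f + s • d) ≤ ENNReal.ofReal (1 - s) * G f + ENNReal.ofReal s * G h := by
      have hm : ∀ u : C(X, ℝ), Measurable fun x => conjGap φ (u x) := fun u =>
        (lowerSemicontinuous_conjGap φ).measurable.comp u.continuous.measurable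
      rw [hGdef]
      simp only
      rw [← lintegral_const_mul _ (hm f), ← lintegral_const_mul _ (hm h),
        ← lintegral_add_left ((hm f).const_mul _)]
      refine lintegral_mono fun x => ?_
      have := conjGap_convex φ (t₁ := f x) (t₂ := h x) (sub_nonneg.2 hs1) hs.le (by ring)
      refine le_trans (le_of_eq ?_) this
      congr 1
      simp [hd]
      ring
    have hfin : ENNReal.ofReal (1 - s) * G f + ENNReal.ofReal s * G h ≠ ∞ :=
      ENNReal.add_ne_top.2 ⟨ENNReal.mul_ne_top ENNReal.ofReal_ne_top hG,
        ENNReal.mul_ne_top ENNReal.ofReal_ne_top hGh⟩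
    refine ⟨(hle.trans_lt (lt_top_iff_ne_top.2 hfin)).ne, ?_⟩
    refine (ENNReal.toReal_mono hfin hle).trans_eq ?_
    rw [ENNReal.toReal_add (ENNReal.mul_ne_top ENNReal.ofReal_ne_top hG)
      (ENNReal.mul_ne_top ENNReal.ofReal_ne_top hGh), ENNReal.toReal_mul, ENNReal.toReal_mul,
      ENNReal.toReal_ofReal (sub_nonneg.2 hs1), ENNReal.toReal_ofReal hs.le]
  set M : ℝ := ε * ∫ z, r z * (d z.1 / ε) ^ 2 ∂ρ
  -- Second-order expansion of the exponential term along `f + s d`, from `|exp v - 1 - v| ≤ v²` for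
  -- `|v| ≤ 1`.
  have hexp : ∀ s : ℝ, 0 < s → s * (‖d‖ / ε) ≤ 1 →
      ε * ∫ z, (gibbs c ε (f + s • d) g z - 1) ∂ρ - ε * ∫ z, (r z - 1) ∂ρ ≤
        s * ∫ x, d x * p x ∂(α : Measure X) + s ^ 2 * M := by
    intro s hs hs1
    have i1 : Integrable (fun z : X × X => d z.1 * r z) ρ := hint (d.comp ContinuousMap.fst * r)
    have i2 : Integrable (fun z : X × X => r z * (d z.1 / ε) ^ 2) ρ :=
      hint (r * ⟨fun z => (d z.1 / ε) ^ 2, by fun_prop⟩)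
    have i3 : Integrable (fun z : X × X => gibbs c ε (f + s • d) g z - 1) ρ :=
      hint (gibbs c ε (f + s • d) g - 1)
    have i4 : Integrable (fun z : X × X => r z - 1) ρ := hint (r - 1)
    rw [← integral_fst_mul_gibbs, ← mul_sub, ← integral_sub i3 i4, ← integral_const_mul,
      ← integral_const_mul, mul_left_comm, ← integral_const_mul (s ^ 2),
      ← integral_const_mul ε (fun z => s ^ 2 * _),
      ← integral_add (i1.const_mul s) ((i2.const_mul (s ^ 2)).const_mul ε)]
    refine integral_mono ((i3.sub i4).const_mul ε)
      ((i1.const_mul s).add ((i2.const_mul (s ^ 2)).const_mul ε)) fun z => ?_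
    have hz : |s * (d z.1 / ε)| ≤ 1 := by
      rw [abs_mul, abs_div, abs_of_pos hs, abs_of_pos hε]
      refine le_trans ?_ hs1
      gcongr
      exact d.norm_coe_le_norm z.1
    have hb := (abs_le.1 (Real.abs_exp_sub_one_sub_id_le hz)).2
    have hr : gibbs c ε (f + s • d) g z = r z * Real.exp (s * (d z.1 / ε)) := by
      simp only [r, gibbs_apply, ← Real.exp_add]
      congr 1
      simp only [ContinuousMap.add_apply, ContinuousMap.smul_apply, smul_eq_mul]
      field_simp
      ring
    have hrpos : 0 < r z := Real.exp_pos _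
    simp only [hr]
    have hk : r z * (Real.exp (s * (d z.1 / ε)) - 1 - s * (d z.1 / ε)) ≤
        r z * (s * (d z.1 / ε)) ^ 2 := mul_le_mul_of_nonneg_left hb hrpos.le
    have hk' := mul_le_mul_of_nonneg_left hk hε.le
    have e1 : ε * (r z * (s * (d z.1 / ε))) = s * (d z.1 * r z) := by field_simp
    nlinarith
  -- The penalty is convex on the segment, so the optimality inequality can be divided by `s`,
  -- leaving an error `s M` that vanishes as `s → 0`.
  have hkey : ∀ s : ℝ, 0 < s → s ≤ 1 → s * (‖d‖ / ε) ≤ 1 →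
      ∫ x, d x ∂(α : Measure X) - ∫ x, d x * p x ∂(α : Measure X) - ((G h).toReal - (G f).toReal) ≤
        s * M := by
    intro s hs hs1 hs2
    have h1 := hreal _ (hseg s hs hs1).1
    have h2 := (hseg s hs hs1).2
    have h3 := hexp s hs hs2
    have h4 : ∫ x, (f + s • d) x ∂(α : Measure X) =
        ∫ x, f x ∂(α : Measure X) + s * ∫ x, d x ∂(α : Measure X) := by
      rw [← integral_const_mul, ← integral_add (ia f) ((ia d).const_mul s)]
      rfl
    rw [h4] at h1
    have h5 : s * (∫ x, d x ∂(α : Measure X) - ∫ x, d x * p x ∂(α : Measure X) -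
        ((G h).toReal - (G f).toReal)) ≤ s * (s * M) := by nlinarith
    exact le_of_mul_le_mul_left h5 hs
  have hfinal : ∫ x, d x ∂(α : Measure X) - ∫ x, d x * p x ∂(α : Measure X) -
      ((G h).toReal - (G f).toReal) ≤ 0 := by
    have hlim : Tendsto (fun s : ℝ => s * M) (𝓝[>] 0) (𝓝 0) := by
      have : Continuous fun s : ℝ => s * M := by fun_prop
      simpa using (this.tendsto 0).mono_left nhdsWithin_le_nhds
    refine ge_of_tendsto hlim ?_
    have hN : 0 < ‖d‖ / ε + 1 := by positivity
    -- This bound on `s` gives both `s ≤ 1` and `s ‖d‖ / ε ≤ 1`.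
    filter_upwards [Ioo_mem_nhdsGT (show (0 : ℝ) < 1 / (‖d‖ / ε + 1) by positivity)] with s hs
    have hs' : s * (‖d‖ / ε + 1) < 1 := (lt_div_iff₀ hN).1 hs.2
    have hdn : 0 ≤ ‖d‖ / ε := by positivity
    have hsd : 0 ≤ s * (‖d‖ / ε) := mul_nonneg hs.1.le hdn
    exact hkey s hs.1 (by nlinarith) (by nlinarith [hs.1])
  have e := integral_one_sub_mul α p
  have ed1 : ∫ x, d x ∂(α : Measure X) = ∫ x, h x ∂(α : Measure X) - ∫ x, f x ∂(α : Measure X) := by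
    rw [← integral_sub (ia h) (ia f)]; rfl
  have ed2 : ∫ x, d x * p x ∂(α : Measure X) =
      ∫ x, h x * p x ∂(α : Measure X) - ∫ x, f x * p x ∂(α : Measure X) := by
    have i1 : Integrable (fun x => h x * p x) (α : Measure X) := ia (h * p)
    have i2 : Integrable (fun x => f x * p x) (α : Measure X) := ia (f * p)
    rw [← integral_sub i1 i2]
    refine integral_congr_ae (Eventually.of_forall fun x => ?_)
    simp only [hd, ContinuousMap.sub_apply]
    ring
  rw [e, e]
  rw [ed1, ed2] at hfinal
  linarith

/-- An optimal first potential satisfies the Fenchel–Young equality almost everywhere. -/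
theorem IsEntropy.ae_isConjPair_of_optimal (hφ : IsEntropy φ) {c : C(X × X, ℝ)} {ε : ℝ}
    (hε : 0 < ε) {α β : FiniteMeasure X}
    {f g : C(X, ℝ)} (hG : ∫⁻ x, conjGap φ (f x) ∂(α : Measure X) ≠ ∞)
    (hGg : ∫⁻ y, conjGap φ (g y) ∂(β : Measure X) ≠ ∞)
    (hopt : ∀ h : C(X, ℝ), dualValue φ c ε α β h g ≤ dualValue φ c ε α β f g) :
    ∀ᵐ x ∂(α : Measure X), IsConjPair φ (gibbsFst c ε β f g x).toNNReal (f x) := by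
  set p := gibbsFst c ε β f g
  have hp0 : ∀ x, 0 ≤ p x := gibbsFst_nonneg c ε β f g
  have hpc : Continuous fun x => (p x).toNNReal := continuous_real_toNNReal.comp p.continuous
  have ia : ∀ u : C(X, ℝ), Integrable u (α : Measure X) := fun u => u.integrable_finiteMeasure α
  set G := ∫⁻ x, conjGap φ (f x) ∂(α : Measure X)
  set I := ∫ x, (1 - p x) * f x ∂(α : Measure X)
  -- The function `φ ∘ p` may be infinite or discontinuous. The selection needs a continuous strict
  -- minorant, supplied by these approximations lowered by `δ`.
  obtain ⟨F, hFc, hFm, hFb, hF⟩ := (hφ.lsc.comp hpc).exists_monotone_continuous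
  have hft : ∀ k x, F k x ≠ ∞ := fun k x => ((hFb k x).trans_lt (ENNReal.natCast_lt_top k)).ne
  let W : ℕ → C(X, ℝ) := fun k => ⟨fun x => (F k x).toReal,
    ENNReal.continuousOn_toReal.comp_continuous (hFc k) (hft k)⟩
  have hWle : ∀ k x, ENNReal.ofReal (W k x) ≤ φ (p x).toNNReal := fun k x => by
    have : F k x ≤ φ (p x).toNNReal := (le_iSup (fun k => F k x) k).trans_eq (hF x)
    simpa [W, ENNReal.ofReal_toReal (hft k x)] using this
  have hW : ∀ k, ∫ x, W k x ∂(α : Measure X) + G.toReal ≤ I := by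
    intro k
    have hδ : ∀ δ : ℝ, 0 < δ →
        ∫ x, W k x ∂(α : Measure X) - δ * (α : Measure X).real Set.univ + G.toReal ≤ I := by
      intro δ hδ
      obtain ⟨h, hh⟩ := hφ.exists_continuous_almost_conj (fun x => (p x).toNNReal) hpc
        (fun x => W k x - δ) ((W k).continuous.sub continuous_const) fun x => by
          by_cases hx : W k x - δ < 0
          · exact Or.inl hx
          · refine Or.inr (lt_of_lt_of_le ?_ (hWle k x))
            rw [ENNReal.ofReal_lt_ofReal_iff (by linarith)]
            linarith
      -- A continuous majorant of the penalty of `h`. Testing optimality against `h` cancels `∫ (1 -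
      -- p) h` and leaves the bound on `∫ W k`, up to `δ` times the mass.
      let v : C(X, ℝ) := (1 - p) * h - (W k - ContinuousMap.const X δ)
      have hv : ∀ x, 0 ≤ v x ∧ conjGap φ (h x) ≤ ENNReal.ofReal (v x) := by
        intro x
        obtain ⟨K, hK0, hK1, hK2⟩ := hh x
        rw [Real.coe_toNNReal _ (hp0 x)] at hK2
        have hKv : K ≤ v x := by
          simp only [v, ContinuousMap.sub_apply, ContinuousMap.mul_apply, ContinuousMap.one_apply,
            ContinuousMap.const_apply]
          linarith
        exact ⟨hK0.trans hKv, hK1.trans (ENNReal.ofReal_le_ofReal hKv)⟩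
      have hGh : ∫⁻ x, conjGap φ (h x) ∂(α : Measure X) ≤
          ENNReal.ofReal (∫ x, v x ∂(α : Measure X)) := by
        rw [ofReal_integral_eq_lintegral_ofReal (ia v) (Eventually.of_forall fun x => (hv x).1)]
        exact lintegral_mono fun x => (hv x).2
      have hfirst := gap_sub_le_of_optimal hε hG hGg hopt h
        (hGh.trans_lt ENNReal.ofReal_lt_top).ne
      have hGh' := ENNReal.toReal_le_of_le_ofReal
        (integral_nonneg fun x => (hv x).1) hGh
      have hvint : ∫ x, v x ∂(α : Measure X) = ∫ x, (1 - p x) * h x ∂(α : Measure X) -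
          (∫ x, W k x ∂(α : Measure X) - δ * (α : Measure X).real Set.univ) := by
        have hc : ∫ _, δ ∂(α : Measure X) = δ * (α : Measure X).real Set.univ := by
          rw [integral_const, smul_eq_mul, mul_comm]
        have j1 : Integrable (fun x => (1 - p x) * h x) (α : Measure X) := ia ((1 - p) * h)
        have j2 : Integrable (fun x => W k x - δ) (α : Measure X) :=
          (ia (W k)).sub (integrable_const δ)
        rw [← hc, ← integral_sub (ia (W k)) (integrable_const δ), ← integral_sub j1 j2]
        rfl
      rw [hvint] at hGh'
      linarith
    have hlim : Tendsto (fun δ : ℝ =>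
        ∫ x, W k x ∂(α : Measure X) - δ * (α : Measure X).real Set.univ + G.toReal) (𝓝[>] 0)
        (𝓝 (∫ x, W k x ∂(α : Measure X) + G.toReal)) := by
      have : Continuous fun δ : ℝ =>
        ∫ x, W k x ∂(α : Measure X) - δ * (α : Measure X).real Set.univ + G.toReal := by fun_prop
      simpa using (this.tendsto 0).mono_left nhdsWithin_le_nhds
    exact le_of_tendsto hlim (eventually_nhdsWithin_of_forall hδ)
  have hφint : ∫⁻ x, φ (p x).toNNReal ∂(α : Measure X) ≤ ENNReal.ofReal (I - G.toReal) := by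
    have hm : ∀ x, φ (p x).toNNReal = ⨆ k, F k x := fun x => (hF x).symm
    simp_rw [hm]
    rw [lintegral_iSup (fun k => (hFc k).measurable) hFm]
    refine iSup_le fun k => ?_
    have : ∫⁻ x, F k x ∂(α : Measure X) = ENNReal.ofReal (∫ x, W k x ∂(α : Measure X)) := by
      rw [ofReal_integral_eq_lintegral_ofReal (ia _)
        (Eventually.of_forall fun x => ENNReal.toReal_nonneg)]
      exact lintegral_congr fun x => (ENNReal.ofReal_toReal (hft k x)).symm
    rw [this]
    exact ENNReal.ofReal_le_ofReal (by linarith [hW k])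
  have hIG : 0 ≤ I - G.toReal := by
    have : 0 ≤ ∫ x, W 0 x ∂(α : Measure X) := integral_nonneg fun x => ENNReal.toReal_nonneg
    linarith [hW 0]
  have m1 : Measurable fun x => φ (p x).toNNReal := hφ.measurable.comp hpc.measurable
  have m2 : Measurable fun x => conjGap φ (f x) :=
    (lowerSemicontinuous_conjGap φ).measurable.comp f.continuous.measurable
  have hφfin : ∫⁻ x, φ (p x).toNNReal ∂(α : Measure X) ≠ ∞ :=
    (hφint.trans_lt ENNReal.ofReal_lt_top).ne
  have a1 := ae_lt_top m1 hφfin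
  have a2 := ae_lt_top m2 hG
  have i1 := integrable_toReal_of_lintegral_ne_top m1.aemeasurable hφfin
  have i2 := integrable_toReal_of_lintegral_ne_top m2.aemeasurable hG
  have i3 : Integrable (fun x => (1 - p x) * f x) (α : Measure X) := ia ((1 - p) * f)
  have hnn : 0 ≤ᵐ[(α : Measure X)] fun x =>
      (φ (p x).toNNReal).toReal + (conjGap φ (f x)).toReal - (1 - p x) * f x := by
    filter_upwards [a1, a2] with x h1 h2
    have := one_sub_mul_le_toReal_add h1.ne h2.ne
    rw [Real.coe_toNNReal _ (hp0 x)] at this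
    exact sub_nonneg.2 this
  -- The Fenchel–Young defect is nonnegative pointwise, while the limit over `k` bounds its integral
  -- by zero.
  have hzero : ∫ x, (φ (p x).toNNReal).toReal + (conjGap φ (f x)).toReal - (1 - p x) * f x
      ∂(α : Measure X) = 0 := by
    refine le_antisymm ?_ (integral_nonneg_of_ae hnn)
    have i12 : Integrable (fun x => (φ (p x).toNNReal).toReal + (conjGap φ (f x)).toReal)
      (α : Measure X) := i1.add i2
    rw [integral_sub i12 i3, integral_add i1 i2, integral_toReal m1.aemeasurable a1,
      integral_toReal m2.aemeasurable a2]
    have := ENNReal.toReal_le_of_le_ofReal hIG hφint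
    simp only [G, I] at this
    linarith
  have hae := (integral_eq_zero_iff_of_nonneg_ae hnn ((i1.add i2).sub i3)).1 hzero
  filter_upwards [a1, a2, hae] with x h1 h2 h3
  refine ⟨h1.ne, h2.ne, ?_⟩
  rw [Real.coe_toNNReal _ (hp0 x)]
  exact sub_eq_zero.1 h3

end Optimality

/-! ### Exchange of the two marginals -/

section Symmetry

variable {X : Type*} [MetricSpace X] [CompactSpace X] [MeasurableSpace X] [BorelSpace X]

theorem gibbsSnd_eq_gibbsFst_swap (c : C(X × X, ℝ)) (ε : ℝ) (α : FiniteMeasure X)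
    (f g : C(X, ℝ)) :
    gibbsSnd c ε α f g = gibbsFst (c.comp ContinuousMap.prodSwap) ε α g f := by
  rw [gibbsSnd, gibbsFst]
  congr 1
  ext z
  simp [add_comm]

theorem dualValue_swap (φ : ℝ≥0 → ℝ≥0∞) (c : C(X × X, ℝ)) (ε : ℝ) (α β : FiniteMeasure X)
    (f g : C(X, ℝ)) :
    dualValue φ (c.comp ContinuousMap.prodSwap) ε β α g f = dualValue φ c ε α β f g := by
  have h : ∫ z, (gibbs (c.comp ContinuousMap.prodSwap) ε g f z - 1)
      ∂((β : Measure X).prod (α : Measure X)) =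
      ∫ z, (gibbs c ε f g z - 1) ∂((α : Measure X).prod (β : Measure X)) := by
    rw [← integral_prod_swap]
    refine integral_congr_ae (Eventually.of_forall fun z => ?_)
    simp [add_comm]
  rw [dualValue, dualValue, h, add_comm (∫ x, g x ∂(β : Measure X)),
    add_comm (∫⁻ x, conjGap φ (g x) ∂(β : Measure X))]

end Symmetry

/-! ### Lipschitz potentials, compactness and continuity of the cost -/

/-- The Arzelà–Ascoli theorem for bounded sets of Lipschitz functions. -/
theorem isCompact_setOf_lipschitzWith_le {X : Type*} [MetricSpace X] (γ : ℝ≥0) (K : ℝ) :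
    IsCompact {f : C(X, ℝ) | LipschitzWith γ f ∧ ∀ x, |f x| ≤ K} := by
  refine ArzelaAscoli.isCompact_of_equicontinuous _ ?_ ?_
  · have h : ContinuousMap.toFun '' {f : C(X, ℝ) | LipschitzWith γ f ∧ ∀ x, |f x| ≤ K} =
        {u : X → ℝ | LipschitzWith γ u} ∩ Set.pi Set.univ fun _ => Set.Icc (-K) K := by
      ext u
      constructor
      · rintro ⟨f, ⟨hf, hfK⟩, rfl⟩
        exact ⟨hf, fun x _ => abs_le.1 (hfK x)⟩
      · rintro ⟨hu, huK⟩
        exact ⟨⟨u, hu.continuous⟩, ⟨hu, fun x => abs_le.2 (huK x (Set.mem_univ x))⟩, rfl⟩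
    rw [h]
    refine (isCompact_univ_pi fun _ => isCompact_Icc).inter_left ?_
    simp only [lipschitzWith_iff_dist_le_mul, Set.ofPred_forall]
    exact isClosed_iInter fun x => isClosed_iInter fun y => isClosed_le
      ((continuous_apply x).dist (continuous_apply y)) continuous_const
  · exact (LipschitzWith.uniformEquicontinuous _ γ fun f => f.2.1).equicontinuous

section LipschitzPotentials

variable {X : Type*} [MetricSpace X] [CompactSpace X] [MeasurableSpace X] [BorelSpace X]
  {φ : ℝ≥0 → ℝ≥0∞}

theorem gibbsFst_congr (c : C(X × X, ℝ)) (ε : ℝ) {β : FiniteMeasure X} {f f' g g' : C(X, ℝ)}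
    (hg : g' =ᵐ[(β : Measure X)] g) {x : X} (hf : f' x = f x) :
    gibbsFst c ε β f' g' x = gibbsFst c ε β f g x := by
  refine integral_congr_ae ?_
  filter_upwards [hg] with y hy
  simp [hy, hf]

/-- The Gibbs density is strictly larger at every `y`, and a nonzero `β` keeps the inequality strict
after integration. -/
theorem gibbsFst_lt_gibbsFst (c : C(X × X, ℝ)) {ε : ℝ} (hε : 0 < ε) {β : FiniteMeasure X}
    (hβ : β ≠ 0) (f g : C(X, ℝ)) {x x' : X}
    (h : ∀ y, f x' - c (x', y) < f x - c (x, y)) :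
    gibbsFst c ε β f g x' < gibbsFst c ε β f g x := by
  have hi : ∀ x, Integrable (fun y => gibbs c ε f g (x, y)) (β : Measure X) := fun x =>
    ((gibbs c ε f g).curry x).integrable_finiteMeasure β
  have hlt : ∀ y, gibbs c ε f g (x', y) < gibbs c ε f g (x, y) := by
    intro y
    simp only [gibbs_apply, Real.exp_lt_exp]
    have := h y
    gcongr ?_ / _
    linarith
  rw [← sub_pos]
  change 0 < ∫ y, gibbs c ε f g (x, y) ∂(β : Measure X) -
    ∫ y, gibbs c ε f g (x', y) ∂(β : Measure X)
  rw [← integral_sub (hi x) (hi x'), integral_pos_iff_support_of_nonneg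
    (fun y => (sub_pos.2 (hlt y)).le) ((hi x).sub (hi x'))]
  have hs : Function.support (fun y => gibbs c ε f g (x, y) - gibbs c ε f g (x', y)) = Set.univ :=
    Set.eq_univ_of_forall fun y => (sub_pos.2 (hlt y)).ne'
  rw [hs, Measure.measure_univ_pos]
  intro h0
  exact hβ (FiniteMeasure.toMeasure_injective (by simpa using h0))

/-- A potential satisfying the Fenchel–Young equality almost everywhere can be replaced by a
Lipschitz one with the same bound. -/
theorem exists_lipschitz_isConjPair {c : C(X × X, ℝ)} {γ : ℝ≥0} {ε : ℝ} (hε : 0 < ε)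
    (hc : ∀ y, LipschitzWith γ fun x => c (x, y)) {α β : FiniteMeasure X} {f g : C(X, ℝ)} {K : ℝ}
    (hK : ‖f‖ ≤ K)
    (h : ∀ᵐ x ∂(α : Measure X), IsConjPair φ (gibbsFst c ε β f g x).toNNReal (f x)) :
    ∃ f' : C(X, ℝ), LipschitzWith γ f' ∧ (∀ x, |f' x| ≤ K) ∧
      (β ≠ 0 → f' =ᵐ[(α : Measure X)] f) ∧
      ∀ g' : C(X, ℝ), g' =ᵐ[(β : Measure X)] g →
        ∀ᵐ x ∂(α : Measure X), IsConjPair φ (gibbsFst c ε β f' g' x).toNNReal (f' x) := by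
  have hfK : ∀ x, |f x| ≤ K := fun x => (f.norm_coe_le_norm x).trans hK
  have hK0 : 0 ≤ K := (norm_nonneg f).trans hK
  by_cases hβ : β = 0
  -- With `β = 0` every marginal density is zero, so the value of `f` at a single good point works
  -- everywhere as a constant potential.
  · have hzero : ∀ u v : C(X, ℝ), ∀ x, gibbsFst c ε β u v x = 0 := by
      intro u v x
      change ∫ y, gibbs c ε u v (x, y) ∂(β : Measure X) = 0
      simp [hβ]
    by_cases hα : (α : Measure X) = 0
    · exact ⟨0, LipschitzWith.const' 0, fun _ => by simpa using hK0, fun hb => absurd hβ hb,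
        fun _ _ => by simp [hα]⟩
    · have : (ae (α : Measure X)).NeBot := ae_neBot.2 hα
      obtain ⟨x₀, hx₀⟩ := h.exists
      rw [hzero] at hx₀
      refine ⟨ContinuousMap.const X (f x₀), LipschitzWith.const' _, fun x => hfK x₀,
        fun hb => absurd hβ hb, fun g' _ => Eventually.of_forall fun x => ?_⟩
      rw [hzero]
      exact hx₀
  · set S : Set X := {x | IsConjPair φ (gibbsFst c ε β f g x).toNNReal (f x)}
    have hlip : LipschitzOnWith γ f S := by
      -- If `f x - f x' > γ d(x, x')`, then `f - c(·, y)` is larger at `x` for all `y`, so the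
      -- marginal density is strictly larger there too. This contradicts the monotonicity of the
      -- subdifferential.
      refine LipschitzOnWith.of_le_add_mul γ fun x hx x' hx' => ?_
      by_contra! hlt
      have hmono := hx.mul_nonpos hx'
      rw [Real.coe_toNNReal _ (gibbsFst_nonneg c ε β f g x),
        Real.coe_toNNReal _ (gibbsFst_nonneg c ε β f g x')] at hmono
      have hp := gibbsFst_lt_gibbsFst c hε hβ f g (x := x) (x' := x') fun y => by
        have := (hc y).dist_le_mul x x'
        have := (le_abs_self _).trans this
        linarith
      have hd : 0 ≤ γ * dist x x' := by positivity
      have : 0 < (gibbsFst c ε β f g x - gibbsFst c ε β f g x') * (f x - f x') :=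
        mul_pos (by linarith) (by linarith)
      linarith
    obtain ⟨k, hk, hkf⟩ := hlip.extend_real
    -- Clamping the Lipschitz extension restores the bound `K` and changes nothing on `S`.
    have hk' : LipschitzWith γ fun x => max (-K) (min K (k x)) := (hk.const_min K).const_max (-K)
    have heq : ∀ x ∈ S, max (-K) (min K (k x)) = f x := by
      intro x hx
      rw [← hkf hx, min_eq_right (abs_le.1 (hfK x)).2, max_eq_right (abs_le.1 (hfK x)).1]
    refine ⟨⟨_, hk'.continuous⟩, hk', fun x => ?_, fun _ => ?_, fun g' hg' => ?_⟩
    · exact abs_le.2 ⟨le_max_left _ _, max_le (by linarith) (min_le_left _ _)⟩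
    · filter_upwards [h] with x hx using heq x hx
    · filter_upwards [h] with x hx
      have hfx := heq x hx
      rw [gibbsFst_congr c ε hg' (f := f) hfx]
      change IsConjPair φ _ (max (-K) (min K (k x)))
      rwa [hfx]

/-- Bounded optimal potentials can be replaced by bounded Lipschitz ones without duality gap. -/
theorem IsEntropy.exists_lipschitz_certificate (hφ : IsEntropy φ) {c : C(X × X, ℝ)} {γ : ℝ≥0}
    {ε : ℝ} (hε : 0 < ε) (hc₁ : ∀ y, LipschitzWith γ fun x => c (x, y))
    (hc₂ : ∀ x, LipschitzWith γ fun y => c (x, y)) {α β : FiniteMeasure X} {f g : C(X, ℝ)} {K : ℝ}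
    (hf : ‖f‖ ≤ K) (hg : ‖g‖ ≤ K)
    (hopt : ∀ f' g' : C(X, ℝ), dualValue φ c ε α β f' g' ≤ dualValue φ c ε α β f g) :
    ∃ f' g' : C(X, ℝ), (LipschitzWith γ f' ∧ ∀ x, |f' x| ≤ K) ∧
      (LipschitzWith γ g' ∧ ∀ x, |g' x| ≤ K) ∧
      primalValue φ c ε α β f' g' ≤ dualValue φ c ε α β f' g' := by
  obtain ⟨hGf, hGg⟩ := conjGap_lintegral_ne_top_of_optimal (hopt 0 0)
  have h₁ := hφ.ae_isConjPair_of_optimal hε hGf hGg fun h => hopt h g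
  have h₂ := hφ.ae_isConjPair_of_optimal (c := c.comp ContinuousMap.prodSwap) hε hGg hGf fun h => by
    rw [dualValue_swap, dualValue_swap]
    exact hopt f h
  obtain ⟨f', hf'L, hf'K, hf'eq, hf'⟩ := exists_lipschitz_isConjPair hε hc₁ hf h₁
  obtain ⟨g', hg'L, hg'K, hg'eq, hg'⟩ := exists_lipschitz_isConjPair hε
    (c := c.comp ContinuousMap.prodSwap) (fun x => hc₂ x) hg h₂
  refine ⟨f', g', ⟨hf'L, hf'K⟩, ⟨hg'L, hg'K⟩,
    primalValue_le_dualValue_of_isConjPair hφ.measurable c ε α β f' g' ?_ ?_⟩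
  -- For `α = 0` the condition is vacuous; otherwise `g'` agrees with `g` `β`-almost everywhere, so
  -- the density is unchanged.
  · by_cases hα : α = 0
    · simp [hα]
    · exact hf' g' (hg'eq hα)
  · simp_rw [gibbsSnd_eq_gibbsFst_swap]
    by_cases hβ : β = 0
    · simp [hβ]
    · exact hg' f' (hf'eq hβ)

/-- Continuity of the cost along weakly convergent marginals with bounded optimal potentials. -/
theorem IsEntropy.tendsto_entropicOT (hφ : IsEntropy φ) {c : C(X × X, ℝ)} {γ : ℝ≥0}
    {ε : ℝ} (hε : 0 < ε) (hc₁ : ∀ y, LipschitzWith γ fun x => c (x, y))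
    (hc₂ : ∀ x, LipschitzWith γ fun y => c (x, y)) {αs βs : ℕ → FiniteMeasure X}
    {α β : FiniteMeasure X} (hα : Tendsto αs atTop (𝓝 α)) (hβ : Tendsto βs atTop (𝓝 β))
    {f g : ℕ → C(X, ℝ)} {K : ℝ} (hK : ∀ n, ‖f n‖ ≤ K ∧ ‖g n‖ ≤ K)
    (hopt : ∀ n, ∀ f' g' : C(X, ℝ),
      dualValue φ c ε (αs n) (βs n) f' g' ≤ dualValue φ c ε (αs n) (βs n) (f n) (g n)) :
    Tendsto (fun n => entropicOT φ (fun x y => c (x, y)) ε (αs n) (βs n)) atTop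
      (𝓝 (entropicOT φ (fun x y => c (x, y)) ε α β)) := by
  choose F G hF hG hFG using fun n =>
    hφ.exists_lipschitz_certificate hε hc₁ hc₂ (hK n).1 (hK n).2 (hopt n)
  refine tendsto_of_subseq_tendsto fun ns hns => ?_
  have hcpt := (isCompact_setOf_lipschitzWith_le (X := X) γ K).prod
    (isCompact_setOf_lipschitzWith_le (X := X) γ K)
  obtain ⟨⟨F₀, G₀⟩, -, ms, hms, hlim⟩ := hcpt.tendsto_subseq
    (x := fun n => (F (ns n), G (ns n))) fun n => ⟨hF (ns n), hG (ns n)⟩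
  refine ⟨ms, ?_⟩
  have hsub : Tendsto (fun n => ns (ms n)) atTop atTop := hns.comp hms.tendsto_atTop
  have hz : Tendsto (fun n => ((αs (ns (ms n)), βs (ns (ms n))), (F (ns (ms n)), G (ns (ms n)))))
      atTop (𝓝 ((α, β), (F₀, G₀))) :=
    ((hα.comp hsub).prodMk_nhds (hβ.comp hsub)).prodMk_nhds hlim
  -- Lower side: at the limit the primal bound dominates the cost, and along the sequence it lies
  -- below the cost by the certificate. The upper side uses the dual bound symmetrically.
  refine tendsto_order.2 ⟨fun a ha => ?_, fun a ha => ?_⟩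
  · have h1 := lowerSemicontinuous_primalValue hφ.lsc c ε ((α, β), (F₀, G₀)) a
      (ha.trans_le (entropicOT_le_primalValue φ c hε α β F₀ G₀))
    filter_upwards [hz.eventually h1] with n hn
    exact hn.trans_le ((hFG _).trans (hφ.dualValue_le_entropicOT c hε _ _ _ _))
  · have h1 := upperSemicontinuous_dualValue φ c ε ((α, β), (F₀, G₀)) a
      ((hφ.dualValue_le_entropicOT c hε α β F₀ G₀).trans_lt ha)
    filter_upwards [hz.eventually h1] with n hn
    exact ((entropicOT_le_primalValue φ c hε _ _ _ _).trans (hFG _)).trans_lt hn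

end LipschitzPotentials

/-- The indices `i` and `j` are independent, so each infimum can be approached within the same `δ`;
since `s + t = 1` the total error is `δ`. Excluding `⊥` makes the cases with `⊤` trivial. -/
theorem le_combo_iInf {ι κ : Sort*} {u : ι → EReal} {v : κ → EReal} {L : EReal} {s t : ℝ}
    (hs : 0 < s) (ht : 0 < t) (hst : s + t = 1) (hu : (⨅ i, u i) ≠ ⊥) (hv : (⨅ j, v j) ≠ ⊥)
    (h : ∀ i j, L ≤ (s : EReal) * u i + (t : EReal) * v j) :
    L ≤ (s : EReal) * (⨅ i, u i) + (t : EReal) * (⨅ j, v j) := by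
  have hne : ∀ (r : ℝ) (x : EReal), 0 < r → x ≠ ⊥ → (r : EReal) * x ≠ ⊥ := by
    intro r x hr hx
    induction x with
    | bot => exact absurd rfl hx
    | coe x => rw [← EReal.coe_mul]; exact EReal.coe_ne_bot _
    | top => rw [EReal.coe_mul_top_of_pos hr]; simp
  by_cases hut : (⨅ i, u i) = ⊤
  · rw [hut, EReal.coe_mul_top_of_pos hs, EReal.top_add_of_ne_bot (hne t _ ht hv)]
    exact le_top
  by_cases hvt : (⨅ j, v j) = ⊤
  · rw [hvt, EReal.coe_mul_top_of_pos ht, EReal.add_top_of_ne_bot (hne s _ hs hu)]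
    exact le_top
  obtain ⟨a, ha⟩ : ∃ a : ℝ, (a : EReal) = (⨅ i, u i) := ⟨_, EReal.coe_toReal hut hu⟩
  obtain ⟨b, hb⟩ : ∃ b : ℝ, (b : EReal) = (⨅ j, v j) := ⟨_, EReal.coe_toReal hvt hv⟩
  rw [← ha, ← hb, ← EReal.coe_mul, ← EReal.coe_mul, ← EReal.coe_add]
  refine EReal.le_of_forall_lt_iff_le.1 fun z hz => ?_
  have hz' : s * a + t * b < z := EReal.coe_lt_coe_iff.1 hz
  set δ := z - (s * a + t * b) with hδ
  have hδ0 : 0 < δ := sub_pos.2 hz'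
  obtain ⟨i, hi⟩ := iInf_lt_iff.1 (show (⨅ i, u i) < ((a + δ : ℝ) : EReal) by
    rw [← ha]; exact EReal.coe_lt_coe_iff.2 (by linarith))
  obtain ⟨j, hj⟩ := iInf_lt_iff.1 (show (⨅ j, v j) < ((b + δ : ℝ) : EReal) by
    rw [← hb]; exact EReal.coe_lt_coe_iff.2 (by linarith))
  calc L ≤ (s : EReal) * u i + (t : EReal) * v j := h i j
    _ ≤ (s : EReal) * ((a + δ : ℝ) : EReal) + (t : EReal) * ((b + δ : ℝ) : EReal) :=
      add_le_add (mul_le_mul_of_nonneg_left hi.le (by exact_mod_cast hs.le))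
        (mul_le_mul_of_nonneg_left hj.le (by exact_mod_cast ht.le))
    _ = (z : EReal) := by
      rw [← EReal.coe_mul, ← EReal.coe_mul, ← EReal.coe_add, EReal.coe_eq_coe_iff]
      have e : s * (a + δ) + t * (b + δ) = s * a + t * b + (s + t) * δ := by ring
      rw [e, hst, hδ]
      ring

/-! ### Convexity in each marginal -/

section Convexity

variable {X : Type*} [MetricSpace X] [CompactSpace X] [MeasurableSpace X] [BorelSpace X]
  {φ : ℝ≥0 → ℝ≥0∞}

/-- Convexity along segments on which the product measure is affine. -/
theorem IsEntropy.entropicOT_combo_le (hφ : IsEntropy φ) (c : C(X × X, ℝ)) {ε : ℝ} (hε : 0 < ε)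
    {α α₁ α₂ β β₁ β₂ : FiniteMeasure X} {s t : ℝ≥0} (hs : 0 < s) (ht : 0 < t) (hst : s + t = 1)
    (hα : α = s • α₁ + t • α₂) (hβ : β = s • β₁ + t • β₂)
    (hαβ : (α : Measure X).prod (β : Measure X) =
      s • (α₁ : Measure X).prod (β₁ : Measure X) + t • (α₂ : Measure X).prod (β₂ : Measure X)) :
    entropicOT φ (fun x y => c (x, y)) ε α β ≤
      ((s : ℝ) : EReal) * entropicOT φ (fun x y => c (x, y)) ε α₁ β₁ +
        ((t : ℝ) : EReal) * entropicOT φ (fun x y => c (x, y)) ε α₂ β₂ :=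
  le_combo_iInf (by exact_mod_cast hs) (by exact_mod_cast ht) (by exact_mod_cast hst)
    (hφ.entropicOT_ne_bot c hε α₁ β₁) (hφ.entropicOT_ne_bot c hε α₂ β₂) fun π₁ π₂ =>
      (iInf_le _ (s • π₁ + t • π₂)).trans
        (transportObjective_combo_le hφ c.continuous ε hα hβ hαβ π₁ π₂)

/-- Convexity of an extended-real functional has to be checked for positive weights only. -/
theorem IsConvexFunctional.of_pos {E : Type*} [AddCommMonoid E] [Module ℝ≥0 E] {F : E → EReal}
    (h : ∀ (x y : E) (s t : ℝ≥0), 0 < s → 0 < t → s + t = 1 →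
      F (s • x + t • y) ≤ ((s : ℝ) : EReal) * F x + ((t : ℝ) : EReal) * F y) :
    IsConvexFunctional F := by
  intro x y s t hst
  rcases eq_zero_or_pos s with rfl | hs
  · obtain rfl : t = 1 := by simpa using hst
    simp
  rcases eq_zero_or_pos t with rfl | ht
  · obtain rfl : s = 1 := by simpa using hst
    simp
  exact h x y s t hs ht hst

theorem IsEntropy.isConvexFunctional_entropicOT_left (hφ : IsEntropy φ) (c : C(X × X, ℝ)) {ε : ℝ}
    (hε : 0 < ε) (β : FiniteMeasure X) :
    IsConvexFunctional fun α : FiniteMeasure X => entropicOT φ (fun x y => c (x, y)) ε α β := by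
  refine IsConvexFunctional.of_pos fun α₁ α₂ s t hs ht hst => ?_
  refine hφ.entropicOT_combo_le c hε hs ht hst rfl ?_ ?_
  · rw [← add_smul, hst, one_smul]
  · simp only [FiniteMeasure.toMeasure_add, FiniteMeasure.toMeasure_smul]
    rw [Measure.add_prod, Measure.prod_smul_left, Measure.prod_smul_left]

theorem IsEntropy.isConvexFunctional_entropicOT_right (hφ : IsEntropy φ) (c : C(X × X, ℝ)) {ε : ℝ}
    (hε : 0 < ε) (α : FiniteMeasure X) :
    IsConvexFunctional fun β : FiniteMeasure X => entropicOT φ (fun x y => c (x, y)) ε α β := by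
  refine IsConvexFunctional.of_pos fun β₁ β₂ s t hs ht hst => ?_
  refine hφ.entropicOT_combo_le c hε hs ht hst ?_ rfl ?_
  · rw [← add_smul, hst, one_smul]
  · simp only [FiniteMeasure.toMeasure_add, FiniteMeasure.toMeasure_smul]
    rw [Measure.prod_add, Measure.prod_smul_right, Measure.prod_smul_right]

end Convexity

/-! ### Failure of joint convexity on Dirac masses -/

section JointConvexity

variable {X : Type*} [MetricSpace X] [CompactSpace X] [MeasurableSpace X] [BorelSpace X]
  {φ : ℝ≥0 → ℝ≥0∞}

/-- If the entropy vanishes on the marginal densities of the Gibbs plan of the zero potentials,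
these potentials are optimal. -/
theorem IsEntropy.entropicOT_eq_of_zero_potentials (hφ : IsEntropy φ) (c : C(X × X, ℝ)) {ε : ℝ}
    (hε : 0 < ε) {α β : FiniteMeasure X}
    (h₁ : ∀ᵐ x ∂(α : Measure X), φ (gibbsFst c ε β 0 0 x).toNNReal = 0)
    (h₂ : ∀ᵐ y ∂(β : Measure X), φ (gibbsSnd c ε α 0 0 y).toNNReal = 0) :
    entropicOT φ (fun x y => c (x, y)) ε α β =
      ((-(ε * ∫ z, (Real.exp (-c z / ε) - 1) ∂((α : Measure X).prod (β : Measure X))) : ℝ) :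
        EReal) := by
  have hpair : ∀ p : ℝ≥0, φ p = 0 → IsConjPair φ p 0 := fun p hp =>
    ⟨by simp [hp], by simp, by simp [hp]⟩
  rw [hφ.entropicOT_eq_dualValue c hε α β 0 0 (primalValue_le_dualValue_of_isConjPair
    hφ.measurable c ε α β 0 0 (h₁.mono fun x hx => hpair _ hx) (h₂.mono fun x hx => hpair _ hx))]
  simp only [dualValue, ContinuousMap.zero_apply, conjGap_zero, lintegral_zero, add_zero,
    EReal.coe_ennreal_zero, sub_zero, gibbs_apply, integral_zero, zero_sub]

theorem gibbsFst_zero_measure (c : C(X × X, ℝ)) (ε : ℝ) (f g : C(X, ℝ)) (x : X) :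
    gibbsFst c ε 0 f g x = 0 := by
  change ∫ y, gibbs c ε f g (x, y) ∂((0 : FiniteMeasure X) : Measure X) = 0
  simp

theorem gibbsSnd_zero_measure (c : C(X × X, ℝ)) (ε : ℝ) (f g : C(X, ℝ)) (x : X) :
    gibbsSnd c ε 0 f g x = 0 := by
  rw [gibbsSnd_eq_gibbsFst_swap, gibbsFst_zero_measure]

theorem IsEntropy.entropicOT_zero_zero (hφ : IsEntropy φ) (c : C(X × X, ℝ)) {ε : ℝ} (hε : 0 < ε) :
    entropicOT φ (fun x y => c (x, y)) ε (0 : FiniteMeasure X) 0 = 0 := by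
  rw [hφ.entropicOT_eq_of_zero_potentials c hε (by simp) (by simp)]
  simp

theorem IsEntropy.entropicOT_zero_right (hφ : IsEntropy φ) (h0 : φ 0 = 0) (c : C(X × X, ℝ))
    {ε : ℝ} (hε : 0 < ε) (α : FiniteMeasure X) :
    entropicOT φ (fun x y => c (x, y)) ε α 0 = 0 := by
  rw [hφ.entropicOT_eq_of_zero_potentials c hε (by simp [gibbsFst_zero_measure, h0]) (by simp)]
  simp

theorem IsEntropy.entropicOT_zero_left (hφ : IsEntropy φ) (h0 : φ 0 = 0) (c : C(X × X, ℝ))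
    {ε : ℝ} (hε : 0 < ε) (β : FiniteMeasure X) :
    entropicOT φ (fun x y => c (x, y)) ε 0 β = 0 := by
  rw [hφ.entropicOT_eq_of_zero_potentials c hε (by simp) (by simp [gibbsSnd_zero_measure, h0])]
  simp

/-- The unit mass at a point, as a finite measure. -/
def pointMass (x : X) : FiniteMeasure X := ⟨Measure.dirac x, inferInstance⟩

theorem integral_smul_pointMass (a : ℝ≥0) (x : X) (u : C(X, ℝ)) :
    ∫ y, u y ∂((a • pointMass x : FiniteMeasure X) : Measure X) = a * u x := by
  rw [FiniteMeasure.toMeasure_smul, integral_smul_nnreal_measure]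
  change a • ∫ y, u y ∂(Measure.dirac x) = a * u x
  rw [integral_dirac]
  rfl

theorem lintegral_smul_pointMass (a : ℝ≥0) (x : X) (u : X → ℝ≥0∞) :
    ∫⁻ y, u y ∂((a • pointMass x : FiniteMeasure X) : Measure X) = a * u x := by
  rw [FiniteMeasure.toMeasure_smul, lintegral_smul_measure]
  change a • ∫⁻ y, u y ∂(Measure.dirac x) = a * u x
  rw [lintegral_dirac]
  rfl

theorem integral_prod_smul_pointMass (a b : ℝ≥0) (x y : X) (F : C(X × X, ℝ)) :
    ∫ z, F z ∂(((a • pointMass x : FiniteMeasure X) : Measure X).prod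
      ((b • pointMass y : FiniteMeasure X) : Measure X)) = a * (b * F (x, y)) := by
  rw [integral_prod_eq_partialIntegral, integral_smul_pointMass]
  congr 1
  exact integral_smul_pointMass b y (F.curry x)

/-- The zero-potential density at `x` is `exp 0 = 1`, where `φ` vanishes. -/
theorem IsEntropy.entropicOT_pointMass_self (hφ : IsEntropy φ) (c : C(X × X, ℝ)) {ε : ℝ}
    (hε : 0 < ε) {x : X} (hx : c (x, x) = 0) :
    entropicOT φ (fun x y => c (x, y)) ε (pointMass x) (pointMass x) = 0 := by
  have h1 : (1 : ℝ≥0) • pointMass x = pointMass x := one_smul _ _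
  have hp : gibbsFst c ε (pointMass x) 0 0 x = 1 := by
    rw [← h1]
    refine (integral_smul_pointMass 1 x ((gibbs c ε 0 0).curry x)).trans ?_
    simp [hx]
  have hp' : gibbsSnd c ε (pointMass x) 0 0 x = 1 := by
    rw [← h1]
    refine (integral_smul_pointMass 1 x
      (((gibbs c ε 0 0).comp ContinuousMap.prodSwap).curry x)).trans ?_
    simp [hx]
  have hae : ∀ u : X → ℝ≥0∞, u x = 0 → ∀ᵐ y ∂(pointMass x : Measure X), u y = 0 := by
    intro u hu
    change ∀ᵐ y ∂(Measure.dirac x), u y = 0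
    rw [ae_dirac_eq]
    exact hu
  rw [hφ.entropicOT_eq_of_zero_potentials c hε
    (hae _ (by rw [hp, Real.toNNReal_one, hφ.map_one]))
    (hae _ (by rw [hp', Real.toNNReal_one, hφ.map_one]))]
  have := integral_prod_smul_pointMass 1 1 x x
    (⟨fun z => Real.exp (-c z / ε) - 1, by fun_prop⟩ : C(X × X, ℝ))
  simp only [h1, ContinuousMap.coe_mk] at this
  rw [this]
  simp [hx]

/-- Equal point masses whose mass is penalized by the entropy have a positive cost. -/
theorem IsEntropy.entropicOT_smul_pointMass_pos (hφ : IsEntropy φ) (c : C(X × X, ℝ)) {ε : ℝ}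
    (hε : 0 < ε) {x : X} (hx : c (x, x) = 0) {p : ℝ≥0} (hp : 0 < p) (hφp : φ p ≠ 0) :
    0 < entropicOT φ (fun x y => c (x, y)) ε (p • pointMass x) (p • pointMass x) := by
  obtain ⟨t, G, hG, htG, hlt⟩ := hφ.exists_conjGap_lt (p := p) (c := 0)
    (Or.inr (by simpa using pos_iff_ne_zero.2 hφp))
  have hp' : (0 : ℝ) < p := by exact_mod_cast hp
  -- The constant potentials `s t` have dual value at least `2 p s ((1 - p) t - G)` minus a term of
  -- order `s²`; the last condition says that the linear gain wins.
  obtain ⟨s, hs0, hs1, hs2, hs3⟩ : ∃ s : ℝ, 0 < s ∧ s ≤ 1 ∧ |2 * s * t / ε| ≤ 1 ∧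
      ε * p * (2 * t / ε) ^ 2 * s < 2 * ((1 - p) * t - G) := by
    have c1 : Continuous fun s : ℝ => |2 * s * t / ε| := by fun_prop
    have c2 : Continuous fun s : ℝ => ε * p * (2 * t / ε) ^ 2 * s := by fun_prop
    have e1 : ∀ᶠ s in 𝓝[>] (0 : ℝ), |2 * s * t / ε| < 1 :=
      ((c1.tendsto' 0 0 (by simp)).mono_left nhdsWithin_le_nhds).eventually_lt_const one_pos
    have e2 : ∀ᶠ s in 𝓝[>] (0 : ℝ), ε * p * (2 * t / ε) ^ 2 * s < 2 * ((1 - p) * t - G) :=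
      ((c2.tendsto' 0 0 (by simp)).mono_left nhdsWithin_le_nhds).eventually_lt_const (by linarith)
    obtain ⟨s, h1, h2, h3⟩ := (e1.and (e2.and (Ioo_mem_nhdsGT one_pos))).exists
    exact ⟨s, h3.1, h3.2.le, h1.le, h2⟩
  refine lt_of_lt_of_le ?_ (hφ.dualValue_le_entropicOT c hε _ _
    (ContinuousMap.const X (s * t)) (ContinuousMap.const X (s * t)))
  have hgap : conjGap φ (s * t) ≤ ENNReal.ofReal (s * G) := by
    have := conjGap_combo_le (φ := φ) hG le_rfl hs0.le (sub_nonneg.2 hs1) (by ring) htG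
      (t₂ := 0) (by simp)
    simpa using this
  have hgap' := ENNReal.toReal_le_of_le_ofReal (by positivity) hgap
  have hgapt : conjGap φ (s * t) ≠ ∞ := (hgap.trans_lt ENNReal.ofReal_lt_top).ne
  have hcoe : ∀ v : ℝ≥0∞, v ≠ ∞ → (v : EReal) = ((v.toReal : ℝ) : EReal) := fun v hv => by
    lift v to ℝ≥0 using hv; rfl
  have hexp := (abs_le.1 (Real.abs_exp_sub_one_sub_id_le hs2)).2
  have hval := integral_prod_smul_pointMass p p x x
    (gibbs c ε (ContinuousMap.const X (s * t)) (ContinuousMap.const X (s * t)) - 1)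
  simp only [ContinuousMap.sub_apply, ContinuousMap.one_apply] at hval
  have hg : gibbs c ε (ContinuousMap.const X (s * t)) (ContinuousMap.const X (s * t)) (x, x) =
      Real.exp (2 * s * t / ε) := by
    simp only [gibbs_apply, ContinuousMap.const_apply, hx]
    congr 1
    ring
  rw [hg] at hval
  have hm : ((p : ℝ≥0∞) * conjGap φ (s * t) + p * conjGap φ (s * t)) ≠ ∞ :=
    ENNReal.add_ne_top.2 ⟨ENNReal.mul_ne_top (by simp) hgapt, ENNReal.mul_ne_top (by simp) hgapt⟩
  rw [dualValue, hval, integral_smul_pointMass, lintegral_smul_pointMass]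
  simp only [ContinuousMap.const_apply]
  rw [hcoe _ hm, ← EReal.coe_sub, EReal.coe_pos, ENNReal.toReal_add
    (ENNReal.mul_ne_top (by simp) hgapt) (ENNReal.mul_ne_top (by simp) hgapt), ENNReal.toReal_mul,
    ENNReal.coe_toReal]
  have k1 : ε * (p * (p * (Real.exp (2 * s * t / ε) - 1))) ≤
      ε * (p * (p * (2 * s * t / ε + (2 * s * t / ε) ^ 2))) := by
    gcongr
    linarith
  have k2 : ε * (p * (p * (2 * s * t / ε + (2 * s * t / ε) ^ 2))) =
      p * s * (2 * p * t + ε * p * (2 * t / ε) ^ 2 * s) := by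
    field_simp
  have k3 : (p : ℝ) * (conjGap φ (s * t)).toReal ≤ p * (s * G) := by gcongr
  have k4 : 0 < p * s * (2 * ((1 - p) * t - G) - ε * p * (2 * t / ε) ^ 2 * s) := by
    have : 0 < 2 * ((1 - p) * t - G) - ε * p * (2 * t / ε) ^ 2 * s := sub_pos.2 hs3
    positivity
  nlinarith

/-- If `φ 0 = 0`, the pairs `(2p δ, 0)` and `(0, 2p δ)` cost nothing but their midpoint does. If `φ
0 ≠ 0`, the segment from `(0, 0)` to `(δ, δ)` serves instead. -/
theorem IsEntropy.not_isConvexFunctional_of_entropy (hφ : IsEntropy φ) [Nonempty X]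
    (c : C(X × X, ℝ)) {ε : ℝ} (hε : 0 < ε) (hdiag : ∀ x, c (x, x) = 0) {p : ℝ≥0} (hp : φ p ≠ 0) :
    ¬ IsConvexFunctional fun q : FiniteMeasure X × FiniteMeasure X =>
      entropicOT φ (fun x y => c (x, y)) ε q.1 q.2 := by
  intro hconv
  obtain ⟨x⟩ := ‹Nonempty X›
  by_cases h0 : φ 0 = 0
  · have hp0 : 0 < p := pos_iff_ne_zero.2 fun h => hp (h ▸ h0)
    have hpos := hφ.entropicOT_smul_pointMass_pos c hε (hdiag x) hp0 hp
    have := hconv ((2 * p) • pointMass x, 0) (0, (2 * p) • pointMass x) (1 / 2) (1 / 2)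
      (add_halves 1)
    have e : ((1 : ℝ≥0) / 2) • (2 * p) • pointMass x = p • pointMass x := by
      rw [smul_smul]
      congr 1
      field_simp
    simp only [Prod.smul_mk, Prod.mk_add_mk, smul_zero, add_zero, zero_add, e,
      hφ.entropicOT_zero_left h0 c hε, hφ.entropicOT_zero_right h0 c hε, mul_zero] at this
    exact this.not_gt hpos
  -- Lower semicontinuity at `0` keeps `φ` positive at some small `q > 0`, as a positive mass is
  -- needed.
  · obtain ⟨q, hq0, hq1, hq⟩ : ∃ q : ℝ≥0, 0 < q ∧ q < 1 ∧ φ q ≠ 0 := by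
      have h1 := (hφ.lsc 0 0 (pos_iff_ne_zero.2 h0)).filter_mono
        (nhdsWithin_le_nhds (s := Set.Ioi 0))
      obtain ⟨q, hq1, hq2⟩ := (h1.and (Ioo_mem_nhdsGT (zero_lt_one (α := ℝ≥0)))).exists
      exact ⟨q, hq2.1, hq2.2, hq1.ne'⟩
    have hpos := hφ.entropicOT_smul_pointMass_pos c hε (hdiag x) hq0 hq
    have := hconv (pointMass x, pointMass x) (0, 0) q (1 - q) (add_tsub_cancel_of_le hq1.le)
    simp only [Prod.smul_mk, Prod.mk_add_mk, smul_zero, add_zero,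
      hφ.entropicOT_pointMass_self c hε (hdiag x), hφ.entropicOT_zero_zero c hε, mul_zero] at this
    exact this.not_gt hpos

/-- Without entropy the cost of `(a δ_x, a δ_y)` is `a² k`. The midpoint of `(δ_x, 0)` and `(0,
δ_y)` gives `k / 4 ≤ 0`, that of `(δ_x, δ_y)` and `(0, 0)` gives `k / 4 ≤ k / 2`; hence `k = 0` and
`c (x, y) = 0`. -/
theorem IsEntropy.not_isConvexFunctional_of_cost (hφ : IsEntropy φ) (hφ0 : ∀ p, φ p = 0)
    (c : C(X × X, ℝ)) {ε : ℝ} (hε : 0 < ε) {x y : X} (hxy : c (x, y) ≠ 0) :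
    ¬ IsConvexFunctional fun q : FiniteMeasure X × FiniteMeasure X =>
      entropicOT φ (fun x y => c (x, y)) ε q.1 q.2 := by
  intro hconv
  set k : ℝ := -(ε * (Real.exp (-c (x, y) / ε) - 1)) with hk
  have hval : ∀ a : ℝ≥0, entropicOT φ (fun x y => c (x, y)) ε (a • pointMass x) (a • pointMass y) =
      ((a * a * k : ℝ) : EReal) := by
    intro a
    rw [hφ.entropicOT_eq_of_zero_potentials c hε (Eventually.of_forall fun _ => hφ0 _)
      (Eventually.of_forall fun _ => hφ0 _)]
    have := integral_prod_smul_pointMass a a x y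
      (⟨fun z => Real.exp (-c z / ε) - 1, by fun_prop⟩ : C(X × X, ℝ))
    simp only [ContinuousMap.coe_mk] at this
    rw [this, hk]
    congr 1
    ring
  have h1 := hconv (pointMass x, 0) (0, pointMass y) (1 / 2) (1 / 2) (add_halves 1)
  have h2 := hconv (pointMass x, pointMass y) (0, 0) (1 / 2) (1 / 2) (add_halves 1)
  have hone := hval 1
  simp only [one_smul] at hone
  simp only [Prod.smul_mk, Prod.mk_add_mk, smul_zero, add_zero, zero_add, hval, hone,
    hφ.entropicOT_zero_left (hφ0 0) c hε, hφ.entropicOT_zero_right (hφ0 0) c hε, mul_zero] at h1 h2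
  rw [← EReal.coe_mul, EReal.coe_le_coe_iff] at h2
  rw [← EReal.coe_zero, EReal.coe_le_coe_iff] at h1
  push_cast at h1 h2
  have hk0 : k = 0 := by linarith
  rw [hk, neg_eq_zero, mul_eq_zero, or_iff_right hε.ne', sub_eq_zero, Real.exp_eq_one_iff,
    div_eq_zero_iff, or_iff_left hε.ne', neg_eq_zero] at hk0
  exact hxy hk0

end JointConvexity

end

theorem mainTheorem10 {X : Type*} [MetricSpace X] [CompactSpace X] [Nonempty X]
    [MeasurableSpace X] [BorelSpace X]
    (C : X → X → ℝ) (γ : ℝ≥0) (hC : IsGroundCost γ C)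
    (ε : ℝ) (hε : 0 < ε)
    (φ : ℝ≥0 → ℝ≥0∞) (hφ : IsEntropy φ) :
    (∀ β : FiniteMeasure X, IsConvexFunctional fun α : FiniteMeasure X => entropicOT φ C ε α β) ∧
    (∀ α : FiniteMeasure X, IsConvexFunctional fun β : FiniteMeasure X => entropicOT φ C ε α β) ∧
    (((∃ p, φ p ≠ 0) ∨ ∃ x y, C x y ≠ 0) →
      ¬ IsConvexFunctional fun p : FiniteMeasure X × FiniteMeasure X =>
        entropicOT φ C ε p.1 p.2) ∧
    (∀ (αs βs : ℕ → FiniteMeasure X) (α β : FiniteMeasure X),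
      Tendsto αs atTop (𝓝 α) → Tendsto βs atTop (𝓝 β) →
      ∀ f g : ℕ → C(X, ℝ),
        (∀ n, IsOptimalPotentials φ C ε (αs n) (βs n) (f n) (g n)) →
        (∃ K : ℝ, ∀ n, ‖f n‖ ≤ K ∧ ‖g n‖ ≤ K) →
        Tendsto (fun n => entropicOT φ C ε (αs n) (βs n)) atTop (𝓝 (entropicOT φ C ε α β))) := by
  let c : C(X × X, ℝ) := ⟨fun z => C z.1 z.2, hC.continuous⟩
  refine ⟨hφ.isConvexFunctional_entropicOT_left c hε, hφ.isConvexFunctional_entropicOT_right c hε,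
    fun h => ?_, fun αs βs α β hα hβ f g hopt ⟨K, hK⟩ => ?_⟩
  · by_cases hφ0 : ∃ p, φ p ≠ 0
    · obtain ⟨p, hp⟩ := hφ0
      exact hφ.not_isConvexFunctional_of_entropy c hε hC.diag hp
    · obtain ⟨x, y, hxy⟩ := h.resolve_left hφ0
      push Not at hφ0
      exact hφ.not_isConvexFunctional_of_cost hφ0 c hε (x := x) (y := y) hxy
  · refine hφ.tendsto_entropicOT (c := c) hε (fun y => ?_) hC.lipschitz hα hβ hK
      fun n f' g' => ?_
    · have : (fun x => c (x, y)) = C y := funext fun x => hC.symm x y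
      rw [this]
      exact hC.lipschitz y
    · rw [← dualFunctional_eq_dualValue hφ.map_one, ← dualFunctional_eq_dualValue hφ.map_one]
      exact hopt n f' g'
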